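/- Theorem. A box in $\mathbb{R}^3$ is a set $\{a+x_1b_1+x_2b_2+x_3b_3 : 0\le x_1,x_2,x_3\le 1\}$ with $a\in\mathbb{R}^3$ and pairwise orthogonal vectors $b_1,b_2,b_3\in\mathbb{R}^3$ (possibly zero, so that boxes may be degenerate and have any orientation); its volume is $\mathrm{Vol}(B)=\|b_1\|\,\|b_2\|\,\|b_3\|$. A bounding box of a set $S$ is a box that contains $S$, and $B_{\mathrm{opt}}(S)$ denotes a bounding box of $S$ of minimum volume. There is an algorithm (one fixed real-RAM program, at unit cost per operation, with exact arithmetic operations and comparisons on reals, and with addition, subtraction, comparison and array indexing on integers) and an absolute constant $C$ such that, for every $n\ge 1$, every set $S$ of $n$ points in $\mathbb{R}^3$ (given as an array of coordinates, in any order) and every real $0<\varepsilon\le 1$, the algorithm on input $(S,\varepsilon)$ halts after at most $C\,(n\log n+n/\varepsilon^3)$ steps and outputs a bounding box $B(S)$ of $S$ (its corner $a$ and its edge vectors $b_1,b_2,b_3$) with $$\mathrm{Vol}(B(S))\le(1+\varepsilon)\,\mathrm{Vol}(B_{\mathrm{opt}}(S)).$$ -/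

import Mathlib

/-- Points and vectors of Euclidean three-space. -/
abbrev Point : Type := EuclideanSpace ℝ (Fin 3)

/-- A (possibly degenerate) box in three-space with arbitrary orientation: a corner and three
pairwise orthogonal edge vectors, some of which may vanish. -/
structure Box : Type where
  corner : Point
  edge : Fin 3 → Point
  orthogonal : ∀ i j : Fin 3, i ≠ j → inner ℝ (edge i) (edge j) = 0

namespace Box

/-- The solid box spanned by the corner and the three edge vectors. -/
def toSet (B : Box) : Set Point :=
  {q | ∃ x : Fin 3 → ℝ, (∀ i, 0 ≤ x i ∧ x i ≤ 1) ∧ q = B.corner + ∑ i, x i • B.edge i}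

/-- The volume of a box: the product of its three edge lengths. -/
noncomputable def vol (B : Box) : ℝ := ∏ i, ‖B.edge i‖

/-- `B` is a bounding box of `S`. -/
def Bounds (B : Box) (S : Set Point) : Prop := S ⊆ B.toSet

/-- `B` is a minimum-volume bounding box of `S`, among the boxes of all orientations. -/
def IsMinVolume (B : Box) (S : Set Point) : Prop :=
  B.Bounds S ∧ ∀ B' : Box, B'.Bounds S → B.vol ≤ B'.vol

end Box

/-! The unit-cost real RAM. A program is a finite text, independent of the input. It uses finitely
many integer and real variables and finitely many integer and real arrays of unbounded length with
random access. Integers can be added, subtracted, compared and used as indices. Reals support exact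
`+`, `-`, `*`, `/`, rational constants and comparisons; there are no roots, no rounding, and no
conversions between integers and reals. -/

namespace RealRAM

/-- A memory configuration: variables and arrays are named by natural numbers. -/
structure State : Type where
  intVar : ℕ → ℕ
  realVar : ℕ → ℝ
  intArr : ℕ → ℕ → ℕ
  realArr : ℕ → ℕ → ℝ

/-- Integer expressions; `get a i` reads entry `i` of array `a`. -/
inductive IExp : Type
  | const (k : ℕ)
  | var (x : ℕ)
  | get (a : ℕ) (i : IExp)
  | add (e f : IExp)
  | sub (e f : IExp)

/-- Real expressions. -/
inductive RExp : Type
  | const (q : ℚ)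
  | var (x : ℕ)
  | get (a : ℕ) (i : IExp)
  | add (e f : RExp)
  | sub (e f : RExp)
  | mul (e f : RExp)
  | div (e f : RExp)

/-- Tests. -/
inductive Test : Type
  | ilt (e f : IExp)
  | rlt (e f : RExp)
  | not (b : Test)
  | and (b c : Test)

/-- Subtraction of integers is truncated at zero. -/
def IExp.eval (s : State) : IExp → ℕ
  | const k => k
  | var x => s.intVar x
  | get a i => s.intArr a (i.eval s)
  | add e f => e.eval s + f.eval s
  | sub e f => e.eval s - f.eval s

/-- Division by zero returns zero. -/
noncomputable def RExp.eval (s : State) : RExp → ℝ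
  | const q => (q : ℝ)
  | var x => s.realVar x
  | get a i => s.realArr a (i.eval s)
  | add e f => e.eval s + f.eval s
  | sub e f => e.eval s - f.eval s
  | mul e f => e.eval s * f.eval s
  | div e f => e.eval s / f.eval s

def Test.eval (s : State) : Test → Prop
  | ilt e f => e.eval s < f.eval s
  | rlt e f => e.eval s < f.eval s
  | not b => ¬ b.eval s
  | and b c => b.eval s ∧ c.eval s

/-- The cost of evaluating an expression: one unit for each constant, memory access and
operation in it. -/
def IExp.cost : IExp → ℕ
  | const _ => 1
  | var _ => 1
  | get _ i => i.cost + 1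
  | add e f => e.cost + f.cost + 1
  | sub e f => e.cost + f.cost + 1

def RExp.cost : RExp → ℕ
  | const _ => 1
  | var _ => 1
  | get _ i => i.cost + 1
  | add e f => e.cost + f.cost + 1
  | sub e f => e.cost + f.cost + 1
  | mul e f => e.cost + f.cost + 1
  | div e f => e.cost + f.cost + 1

def Test.cost : Test → ℕ
  | ilt e f => e.cost + f.cost + 1
  | rlt e f => e.cost + f.cost + 1
  | not b => b.cost + 1
  | and b c => b.cost + c.cost + 1

/-- Programs: assignments to variables, assignments to array entries (`putInt a i e` sets entry `i`
of array `a` to `e`), sequential composition, branching and while-loops. -/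
inductive Program : Type
  | skip
  | setInt (x : ℕ) (e : IExp)
  | setReal (x : ℕ) (e : RExp)
  | putInt (a : ℕ) (i : IExp) (e : IExp)
  | putReal (a : ℕ) (i : IExp) (e : RExp)
  | seq (P Q : Program)
  | branch (b : Test) (P Q : Program)
  | loop (b : Test) (P : Program)

def State.setInt (s : State) (x v : ℕ) : State :=
  { s with intVar := Function.update s.intVar x v }

noncomputable def State.setReal (s : State) (x : ℕ) (v : ℝ) : State :=
  { s with realVar := Function.update s.realVar x v }

def State.putInt (s : State) (a i v : ℕ) : State :=
  { s with intArr := Function.update s.intArr a (Function.update (s.intArr a) i v) }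

noncomputable def State.putReal (s : State) (a i : ℕ) (v : ℝ) : State :=
  { s with realArr := Function.update s.realArr a (Function.update (s.realArr a) i v) }

/-- `Exec P s t s'`: started in state `s`, the program `P` halts after exactly `t` time units in
state `s'`. -/
inductive Exec : Program → State → ℕ → State → Prop
  | skip (s : State) : Exec .skip s 1 s
  | setInt (s : State) (x : ℕ) (e : IExp) :
      Exec (.setInt x e) s (e.cost + 1) (s.setInt x (e.eval s))
  | setReal (s : State) (x : ℕ) (e : RExp) :
      Exec (.setReal x e) s (e.cost + 1) (s.setReal x (e.eval s))
  | putInt (s : State) (a : ℕ) (i e : IExp) :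
      Exec (.putInt a i e) s (i.cost + e.cost + 1) (s.putInt a (i.eval s) (e.eval s))
  | putReal (s : State) (a : ℕ) (i : IExp) (e : RExp) :
      Exec (.putReal a i e) s (i.cost + e.cost + 1) (s.putReal a (i.eval s) (e.eval s))
  | seq {P Q : Program} {s s' s'' : State} {t u : ℕ} :
      Exec P s t s' → Exec Q s' u s'' → Exec (.seq P Q) s (t + u) s''
  | branchTrue {b : Test} {P Q : Program} {s s' : State} {t : ℕ} :
      b.eval s → Exec P s t s' → Exec (.branch b P Q) s (b.cost + 1 + t) s'
  | branchFalse {b : Test} {P Q : Program} {s s' : State} {t : ℕ} :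
      ¬ b.eval s → Exec Q s t s' → Exec (.branch b P Q) s (b.cost + 1 + t) s'
  | loopDone {b : Test} {P : Program} {s : State} :
      ¬ b.eval s → Exec (.loop b P) s (b.cost + 1) s
  | loopStep {b : Test} {P : Program} {s s' s'' : State} {t u : ℕ} :
      b.eval s → Exec P s t s' → Exec (.loop b P) s' u s'' →
      Exec (.loop b P) s (b.cost + 1 + t + u) s''

/-- Execution is deterministic: running time and final state are determined by the program and
the initial state. -/
theorem Exec.deterministic {P : Program} {s s₁ s₂ : State} {t₁ t₂ : ℕ}
    (h₁ : Exec P s t₁ s₁) (h₂ : Exec P s t₂ s₂) : t₁ = t₂ ∧ s₁ = s₂ := by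
  induction h₁ generalizing t₂ s₂ with
  | skip | setInt | setReal | putInt | putReal => cases h₂; exact ⟨rfl, rfl⟩
  | seq _ _ ihP ihQ =>
    cases h₂ with
    | seq hP hQ =>
      obtain ⟨rfl, rfl⟩ := ihP hP
      obtain ⟨rfl, rfl⟩ := ihQ hQ
      exact ⟨rfl, rfl⟩
  | branchTrue hb _ ih =>
    cases h₂ with
    | branchTrue _ h => obtain ⟨rfl, rfl⟩ := ih h; exact ⟨rfl, rfl⟩
    | branchFalse hn _ => exact absurd hb hn
  | branchFalse hn _ ih =>
    cases h₂ with
    | branchTrue hb _ => exact absurd hb hn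
    | branchFalse _ h => obtain ⟨rfl, rfl⟩ := ih h; exact ⟨rfl, rfl⟩
  | loopDone hn =>
    cases h₂ with
    | loopDone _ => exact ⟨rfl, rfl⟩
    | loopStep hb _ _ => exact absurd hb hn
  | loopStep hb _ _ ihP ihL =>
    cases h₂ with
    | loopDone hn => exact absurd hb hn
    | loopStep _ hP hL =>
      obtain ⟨rfl, rfl⟩ := ihP hP
      obtain ⟨rfl, rfl⟩ := ihL hL
      exact ⟨rfl, rfl⟩

/-- The input format: integer variable `0` holds the number of points, real variable `0` holds `ε`,
and the coordinates of the `k`-th point are entry `k` of the real arrays `0`, `1`, `2`. All other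
memory is zero. -/
noncomputable def input {n : ℕ} (p : Fin n → Point) (ε : ℝ) : State where
  intVar x := if x = 0 then n else 0
  realVar x := if x = 0 then ε else 0
  intArr _ _ := 0
  realArr a k := if h : a < 3 ∧ k < n then p ⟨k, h.2⟩ ⟨a, h.1⟩ else 0

/-- The vector whose coordinates are entry `k` of the real arrays `0`, `1`, `2`. -/
noncomputable def State.vector (s : State) (k : ℕ) : Point :=
  WithLp.toLp 2 fun j : Fin 3 => s.realArr j k

/-- The output format: the box `B` is stored in `s`, its corner as the vector number `0` and its
edges as the vectors number `1`, `2`, `3`. -/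
def State.Outputs (s : State) (B : Box) : Prop :=
  s.vector 0 = B.corner ∧ ∀ i : Fin 3, s.vector ((i : ℕ) + 1) = B.edge i

end RealRAM

/-!
A bounding box whose edges are parallel to an orthogonal frame `D` is smallest when it fits tightly,
and its volume is then `∏ i, width p (D i) / ‖D i‖`. By compactness of the set of orthonormal frames
a minimum-volume box exists (`MinBox.exists_isMinVolume`). The algorithm evaluates this product, in
time `O(n)`, for `O(1 / ε ^ 3)` frames, and keeps the best box. Neither convex hulls nor sorting are
needed, so that the running time is even `O(n / ε ^ 3)`.

A grid of rotations would not do, as the optimal box may be arbitrarily long or flat; the frames are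
adapted to the shape of the point set. The greedy construction `MinBox.IsGreedy` (take a point
farthest from the first point, then one farthest from the line through both, then one farthest from
the plane through the three) yields orthogonal vectors `v 0`, `v 1`, `v 2` of decreasing lengths
`a`, `b`, `c`. The width in a direction `d` agrees up to constant factors with
`|⟪d, v 0⟫| + |⟪d, v 1⟫| + |⟪d, v 2⟫|` (`MinBox.IsGreedy.isReference`, `MinBox.width_comb_le`), and
`a * b * c` agrees with the minimum volume up to a constant factor. Everything is rational in the
input, and squared volumes are compared, so no square roots occur.

Let `u` be an optimal orthonormal frame. One of the six terms of its determinant in the coordinates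
of the `v i` has absolute value at least `1 / 6`, so `u` can be numbered such that `u i` is not
nearly orthogonal to `v i`. As the product of the widths of the `u i` is at most `8 * a * b * c`,
each width is at most a constant times the length of `v i`, which bounds the component of `u 2`
along `v 0` by `c / a`, that along `v 1` by `c / b`, and the component of `u 1` along `v 0` by
`b / a`, up to constants. In these units three bounded slopes describe `u` up to scaling
(`MinBox.frame`, `MinBox.exists_frame_eq_smul`). A change of the slopes by a small multiple of `ε`
changes each width and each norm by a factor close to `1` (`MinBox.width_frame_le`,
`MinBox.prod_norm_frame_ge`), so some frame of a cubic grid with step proportional to `ε` is good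
enough (`MinBox.exists_good_parameters`).

If the points are coplanar, then `v 2 = 0`, and the box centred at the first point with edges
`2 • v i` is a bounding box of volume `0`; the search is then omitted.

Programs are verified with the predicate `RealRAM.Runs`, for total correctness within a time bound,
and with `RealRAM.Exec.frame`, by which a program changes only the variables that it assigns to.
-/

namespace MinBox

open scoped InnerProductSpace

/-! ### Widths of a point set -/

section Width

variable {ι : Type*} [Finite ι] (p : ι → Point)

/-- The extent of the point set in the direction `d`, scaled by the length of `d`. -/
noncomputable def width (d : Point) : ℝ := (⨆ k, ⟪p k, d⟫_ℝ) - ⨅ k, ⟪p k, d⟫_ℝ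

lemma iInf_inner_le (d : Point) (k : ι) : ⨅ k, ⟪p k, d⟫_ℝ ≤ ⟪p k, d⟫_ℝ :=
  ciInf_le (Set.finite_range _).bddBelow k

lemma inner_le_iSup (d : Point) (k : ι) : ⟪p k, d⟫_ℝ ≤ ⨆ k, ⟪p k, d⟫_ℝ :=
  le_ciSup (f := fun k => ⟪p k, d⟫_ℝ) (Set.finite_range _).bddAbove k

lemma abs_inner_sub_le_width (d : Point) (k l : ι) : |⟪p k - p l, d⟫_ℝ| ≤ width p d := by
  have h1 := iInf_inner_le p d k
  have h2 := iInf_inner_le p d l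
  have h3 := inner_le_iSup p d k
  have h4 := inner_le_iSup p d l
  rw [inner_sub_left, abs_le, width]
  constructor <;> linarith

variable [Nonempty ι]

lemma width_le {d : Point} {c : ℝ} (h : ∀ k l, ⟪p k - p l, d⟫_ℝ ≤ c) : width p d ≤ c := by
  obtain ⟨k, hk⟩ := exists_eq_ciSup_of_finite (f := fun k => ⟪p k, d⟫_ℝ)
  obtain ⟨l, hl⟩ := exists_eq_ciInf_of_finite (f := fun k => ⟪p k, d⟫_ℝ)
  have := h k l
  rw [inner_sub_left] at this
  rw [width, ← hk, ← hl]
  exact this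

lemma width_nonneg (d : Point) : 0 ≤ width p d :=
  (abs_nonneg _).trans
    (abs_inner_sub_le_width p d (Classical.arbitrary ι) (Classical.arbitrary ι))

lemma width_smul_le (c : ℝ) (d : Point) : width p (c • d) ≤ |c| * width p d := by
  refine width_le p fun k l => ?_
  rw [inner_smul_right]
  refine (le_abs_self _).trans ?_
  rw [abs_mul]
  exact mul_le_mul_of_nonneg_left (abs_inner_sub_le_width p d k l) (abs_nonneg c)

lemma width_le_add (d d' : Point) : width p d' ≤ width p d + width p (d' - d) := by
  refine width_le p fun k l => ?_
  have h1 := (abs_le.1 (abs_inner_sub_le_width p d k l)).2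
  have h2 := (abs_le.1 (abs_inner_sub_le_width p (d' - d) k l)).2
  rw [inner_sub_right] at h2
  linarith

lemma continuous_width : Continuous (width p) := by
  have := Fintype.ofFinite ι
  have h1 : Continuous fun d : Point => ⨆ k, ⟪p k, d⟫_ℝ := by
    simp_rw [← Finset.sup'_univ_eq_ciSup]
    exact Continuous.finset_sup'_apply _ fun k _ => by fun_prop
  have h2 : Continuous fun d : Point => ⨅ k, ⟪p k, d⟫_ℝ := by
    simp_rw [← Finset.inf'_univ_eq_ciInf]
    exact Continuous.finset_inf'_apply _ fun k _ => by fun_prop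
  exact h1.sub h2

/-- The orthonormal frames form a compact set, on which the product of the widths, being
continuous, has a minimum. -/
lemma exists_optimal_frame : ∃ u : Fin 3 → Point, Orthonormal ℝ u ∧
    ∀ u' : Fin 3 → Point, Orthonormal ℝ u' → ∏ i, width p (u i) ≤ ∏ i, width p (u' i) := by
  have hclosed : IsClosed {u : Fin 3 → Point | Orthonormal ℝ u} := by
    have : {u : Fin 3 → Point | Orthonormal ℝ u} =
        ⋂ i, ⋂ j, {u : Fin 3 → Point | ⟪u i, u j⟫_ℝ = if i = j then 1 else 0} := by
      ext u
      simp only [Set.mem_ofPred_eq, Set.mem_iInter]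
      exact orthonormal_iff_ite
    rw [this]
    refine isClosed_iInter fun i => isClosed_iInter fun j => isClosed_eq ?_ continuous_const
    fun_prop
  have hcompact : IsCompact {u : Fin 3 → Point | Orthonormal ℝ u} := by
    refine Metric.isCompact_of_isClosed_isBounded hclosed
      ((Metric.isBounded_closedBall (x := (0 : Fin 3 → Point)) (r := 1)).subset fun u hu => ?_)
    rw [mem_closedBall_zero_iff, pi_norm_le_iff_of_nonneg zero_le_one]
    exact fun i => (hu.1 i).le
  obtain ⟨u, hu, hmin⟩ := hcompact.exists_isMinOn
    (f := fun u : Fin 3 → Point => ∏ i, width p (u i))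
    ⟨_, (EuclideanSpace.basisFun (Fin 3) ℝ).orthonormal⟩
    (Continuous.continuousOn (continuous_finsetProd _ fun i _ =>
      (continuous_width p).comp (continuous_apply i)))
  exact ⟨u, hu, fun u' hu' => hmin hu'⟩

end Width

/-! ### Boxes and orthogonal frames -/

section Frames

/-- Pairwise orthogonal vectors, some of which may vanish, are the multiples by their norms of the
members of an orthonormal basis. -/
lemma exists_orthonormalBasis_eq_norm_smul {D : Fin 3 → Point}
    (hD : ∀ i j, i ≠ j → ⟪D i, D j⟫_ℝ = 0) :
    ∃ b : OrthonormalBasis (Fin 3) ℝ Point, ∀ i, D i = ‖D i‖ • b i := by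
  have hv : Orthonormal ℝ (({i | D i ≠ 0} : Set (Fin 3)).domRestrict fun i => (‖D i‖)⁻¹ • D i) := by
    constructor
    · rintro ⟨i, hi⟩
      change ‖(‖D i‖)⁻¹ • D i‖ = 1
      rw [norm_smul, norm_inv, norm_norm]
      exact inv_mul_cancel₀ (norm_ne_zero_iff.2 hi)
    · rintro ⟨i, hi⟩ ⟨j, hj⟩ hij
      have : i ≠ j := fun h => hij (Subtype.ext h)
      change ⟪(‖D i‖)⁻¹ • D i, (‖D j‖)⁻¹ • D j⟫_ℝ = 0
      simp [inner_smul_left, inner_smul_right, hD i j this]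
  obtain ⟨b, hb⟩ := hv.exists_orthonormalBasis_extension_of_card_eq (by simp)
  refine ⟨b, fun i => ?_⟩
  by_cases hi : D i = 0
  · simp [hi]
  · rw [hb i hi, smul_smul, mul_inv_cancel₀ (norm_ne_zero_iff.2 hi), one_smul]

lemma sum_inner_div_smul {D : Fin 3 → Point} (hD : ∀ i j, i ≠ j → ⟪D i, D j⟫_ℝ = 0)
    (h0 : ∀ i, D i ≠ 0) (q : Point) : q = ∑ i, (⟪q, D i⟫_ℝ / ‖D i‖ ^ 2) • D i := by
  obtain ⟨b, hb⟩ := exists_orthonormalBasis_eq_norm_smul hD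
  conv_lhs => rw [← b.sum_repr' q]
  refine Finset.sum_congr rfl fun i _ => ?_
  have hi := norm_ne_zero_iff.2 (h0 i)
  have h1 : ⟪q, D i⟫_ℝ = ‖D i‖ * ⟪b i, q⟫_ℝ := by
    conv_lhs => rw [hb i, inner_smul_right, real_inner_comm]
  have h2 : (⟪q, D i⟫_ℝ / ‖D i‖ ^ 2) • D i
      = (⟪q, D i⟫_ℝ / ‖D i‖ ^ 2 * ‖D i‖) • b i := by
    conv_lhs => rw [hb i, smul_smul, ← hb i]
  rw [h2, h1]
  congr 1
  field_simp

variable {ι : Type*} [Finite ι] (p : ι → Point)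

/-- The smallest bounding box of a point set whose edges are parallel to the given pairwise
orthogonal vectors; these need not be normalized. -/
noncomputable def frameBox (D : Fin 3 → Point) (hD : ∀ i j, i ≠ j → ⟪D i, D j⟫_ℝ = 0) : Box where
  corner := ∑ i, ((⨅ k, ⟪p k, D i⟫_ℝ) / ‖D i‖ ^ 2) • D i
  edge i := (width p (D i) / ‖D i‖ ^ 2) • D i
  orthogonal i j hij := by simp [inner_smul_left, inner_smul_right, hD i j hij]

lemma frameBox_bounds {D : Fin 3 → Point} (hD : ∀ i j, i ≠ j → ⟪D i, D j⟫_ℝ = 0)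
    (h0 : ∀ i, D i ≠ 0) : (frameBox p D hD).Bounds (Set.range p) := by
  rintro _ ⟨k, rfl⟩
  have h1 := fun i => iInf_inner_le p (D i) k
  have h2 := fun i => inner_le_iSup p (D i) k
  refine ⟨fun i => (⟪p k, D i⟫_ℝ - ⨅ k, ⟪p k, D i⟫_ℝ) / width p (D i), fun i => ⟨?_, ?_⟩, ?_⟩
  · exact div_nonneg (sub_nonneg.2 (h1 i)) (by unfold width; linarith [h1 i, h2 i])
  · exact div_le_one_of_le₀ (by unfold width; linarith [h2 i])
      (by unfold width; linarith [h1 i, h2 i])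
  · conv_lhs => rw [sum_inner_div_smul hD h0 (p k)]
    simp only [frameBox]
    rw [← Finset.sum_add_distrib]
    refine Finset.sum_congr rfl fun i _ => ?_
    rw [smul_smul, ← add_smul]
    congr 1
    by_cases hw : width p (D i) = 0
    -- a vanishing width forces the inner product to be equal to its minimum
    · have : ⟪p k, D i⟫_ℝ = ⨅ k, ⟪p k, D i⟫_ℝ :=
        le_antisymm (by unfold width at hw; linarith [h2 i]) (h1 i)
      rw [hw, this]
      simp
    · field_simp
      ring

lemma vol_frameBox [Nonempty ι] {D : Fin 3 → Point} (hD : ∀ i j, i ≠ j → ⟪D i, D j⟫_ℝ = 0)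
    (h0 : ∀ i, D i ≠ 0) : (frameBox p D hD).vol = ∏ i, width p (D i) / ‖D i‖ := by
  unfold Box.vol
  refine Finset.prod_congr rfl fun i _ => ?_
  have hi := norm_ne_zero_iff.2 (h0 i)
  simp only [frameBox, norm_smul, norm_div, norm_pow, norm_norm]
  rw [Real.norm_of_nonneg (width_nonneg p _)]
  field_simp

lemma exists_orthonormal_prod_width_le_vol [Nonempty ι] {B : Box} (hB : B.Bounds (Set.range p)) :
    ∃ u : Fin 3 → Point, Orthonormal ℝ u ∧ ∏ i, width p (u i) ≤ B.vol := by
  obtain ⟨b, hb⟩ := exists_orthonormalBasis_eq_norm_smul B.orthogonal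
  refine ⟨b, b.orthonormal, Finset.prod_le_prod (fun i _ => width_nonneg p _) fun i _ => ?_⟩
  refine width_le p fun k l => ?_
  obtain ⟨x, hx, hk⟩ := hB ⟨k, rfl⟩
  obtain ⟨y, hy, hl⟩ := hB ⟨l, rfl⟩
  have hsum : ∀ z : Fin 3 → ℝ, ⟪∑ j, z j • B.edge j, b i⟫_ℝ = z i * ‖B.edge i‖ := by
    intro z
    have : ∑ j, z j • B.edge j = ∑ j, (z j * ‖B.edge j‖) • b j := by
      refine Finset.sum_congr rfl fun j _ => ?_
      conv_lhs => rw [hb j, smul_smul]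
    rw [this, b.orthonormal.inner_left_fintype]
    simp
  rw [hk, hl, add_sub_add_left_eq_sub, inner_sub_left, hsum, hsum, ← sub_mul]
  nlinarith [(hx i).2, (hy i).1, norm_nonneg (B.edge i)]

/-- A minimum-volume bounding box exists, and its volume is the least product of the widths in the
directions of an orthonormal frame. -/
lemma exists_isMinVolume [Nonempty ι] : ∃ (B : Box) (u : Fin 3 → Point),
    B.IsMinVolume (Set.range p) ∧ Orthonormal ℝ u ∧ B.vol = ∏ i, width p (u i) := by
  obtain ⟨u, hu, hmin⟩ := exists_optimal_frame p
  have hvol : (frameBox p u fun i j hij => hu.2 hij).vol = ∏ i, width p (u i) := by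
    rw [vol_frameBox p _ hu.ne_zero]
    simp [hu.1]
  refine ⟨frameBox p u fun i j hij => hu.2 hij, u,
    ⟨frameBox_bounds p _ hu.ne_zero, fun B' hB' => ?_⟩, hu, hvol⟩
  obtain ⟨u', hu', hle⟩ := exists_orthonormal_prod_width_le_vol p hB'
  rw [hvol]
  exact (hmin u' hu').trans hle

end Frames

/-! ### Reference vectors -/

section Reference

variable {ι : Type*} (p : ι → Point)

/-- Pairwise orthogonal vectors, in order of decreasing length, whose box has the shape of the
point set up to a constant factor: inner products with them bound the widths of the point set from
above and from below. -/
structure IsReference (v : Fin 3 → Point) : Prop where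
  orthogonal : ∀ i j, i ≠ j → ⟪v i, v j⟫_ℝ = 0
  norm_one_le : ‖v 1‖ ≤ ‖v 0‖
  norm_two_le : ‖v 2‖ ≤ ‖v 1‖
  abs_inner_sub_le : ∀ k l i, |⟪p k - p l, v i⟫_ℝ| ≤ 2 * ‖v i‖ ^ 2
  abs_inner_zero_le : ∀ d, |⟪d, v 0⟫_ℝ| ≤ width p d
  abs_inner_one_le : ∀ d, |⟪d, v 1⟫_ℝ| ≤ 2 * width p d
  abs_inner_two_le : ∀ d, |⟪d, v 2⟫_ℝ| ≤ 4 * width p d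

/-- What remains of `x` after subtraction of its projections to the lines spanned by `a`, `b`
and `c`. A vanishing vector contributes nothing, by the convention for division by zero. -/
noncomputable def residual (a b c x : Point) : Point :=
  x - (⟪x, a⟫_ℝ / ⟪a, a⟫_ℝ) • a - (⟪x, b⟫_ℝ / ⟪b, b⟫_ℝ) • b - (⟪x, c⟫_ℝ / ⟪c, c⟫_ℝ) • c

@[simp] lemma residual_zero (x : Point) : residual 0 0 0 x = x := by simp [residual]

lemma inner_residual_left (a x : Point) : ⟪x - (⟪x, a⟫_ℝ / ⟪a, a⟫_ℝ) • a, a⟫_ℝ = 0 := by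
  by_cases h : a = 0
  · simp [h]
  · have : ⟪a, a⟫_ℝ ≠ 0 := inner_self_ne_zero.2 h
    rw [inner_sub_left, real_inner_smul_left, div_mul_cancel₀ _ this, sub_self]

lemma abs_div_inner_self_le {x a : Point} (h : |⟪x, a⟫_ℝ| ≤ ‖a‖ ^ 2) :
    |⟪x, a⟫_ℝ / ⟪a, a⟫_ℝ| ≤ 1 := by
  rw [abs_div, real_inner_self_eq_norm_sq, abs_of_nonneg (sq_nonneg ‖a‖)]
  exact div_le_one_of_le₀ h (sq_nonneg _)

/-- The vectors found by the greedy construction: each is a longest residual, with respect to the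
preceding ones, of the points seen from a base point `p o`. -/
structure IsGreedy (o : ι) (v : Fin 3 → Point) : Prop where
  zero_mem : ∃ k, v 0 = residual 0 0 0 (p k - p o)
  one_mem : ∃ k, v 1 = residual (v 0) 0 0 (p k - p o)
  two_mem : ∃ k, v 2 = residual (v 0) (v 1) 0 (p k - p o)
  zero_max : ∀ k, ‖residual 0 0 0 (p k - p o)‖ ≤ ‖v 0‖
  one_max : ∀ k, ‖residual (v 0) 0 0 (p k - p o)‖ ≤ ‖v 1‖
  two_max : ∀ k, ‖residual (v 0) (v 1) 0 (p k - p o)‖ ≤ ‖v 2‖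

variable {p} {o : ι} {v : Fin 3 → Point}

namespace IsGreedy

lemma inner_one_zero (h : IsGreedy p o v) : ⟪v 1, v 0⟫_ℝ = 0 := by
  obtain ⟨k, hk⟩ := h.one_mem
  have := inner_residual_left (v 0) (p k - p o)
  rw [hk]
  simpa [residual] using this

lemma inner_residual_zero (h : IsGreedy p o v) (x : Point) :
    ⟪residual (v 0) (v 1) 0 x, v 0⟫_ℝ = 0 := by
  have h1 := inner_residual_left (v 0) x
  simp only [residual, smul_zero, sub_zero]
  rw [inner_sub_left, h1, real_inner_smul_left, h.inner_one_zero]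
  simp

lemma inner_residual_one (h : IsGreedy p o v) (x : Point) :
    ⟪residual (v 0) (v 1) 0 x, v 1⟫_ℝ = 0 := by
  have h1 := inner_residual_left (v 1) x
  have h2 : ⟪v 0, v 1⟫_ℝ = 0 := by rw [real_inner_comm]; exact h.inner_one_zero
  simp only [residual, smul_zero, sub_zero]
  rw [inner_sub_left] at h1 ⊢
  rw [inner_sub_left, real_inner_smul_left (v 0), h2]
  linarith

lemma inner_two_zero (h : IsGreedy p o v) : ⟪v 2, v 0⟫_ℝ = 0 := by
  obtain ⟨k, hk⟩ := h.two_mem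
  rw [hk]
  exact h.inner_residual_zero _

lemma inner_two_one (h : IsGreedy p o v) : ⟪v 2, v 1⟫_ℝ = 0 := by
  obtain ⟨k, hk⟩ := h.two_mem
  rw [hk]
  exact h.inner_residual_one _

lemma orthogonal (h : IsGreedy p o v) (i j : Fin 3) (hij : i ≠ j) : ⟪v i, v j⟫_ℝ = 0 := by
  have h1 := h.inner_one_zero
  have h2 := h.inner_two_zero
  have h3 := h.inner_two_one
  fin_cases i <;> fin_cases j <;> first
    | exact absurd rfl hij
    | assumption
    | (rw [real_inner_comm]; assumption)

lemma norm_one_le (h : IsGreedy p o v) : ‖v 1‖ ≤ ‖v 0‖ := by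
  obtain ⟨k, hk⟩ := h.one_mem
  have h0 := h.zero_max k
  rw [residual_zero] at h0
  -- `v 1` is a projection of `p k - p o`
  have h1 : ⟪p k - p o, v 1⟫_ℝ = ‖v 1‖ ^ 2 := by
    have : p k - p o = v 1 + (⟪p k - p o, v 0⟫_ℝ / ⟪v 0, v 0⟫_ℝ) • v 0 := by
      rw [hk]; simp [residual]
    have h01 : ⟪v 0, v 1⟫_ℝ = 0 := h.orthogonal 0 1 (by decide)
    conv_lhs => rw [this, inner_add_left, real_inner_smul_left, h01]
    rw [real_inner_self_eq_norm_sq]; ring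
  have h2 := real_inner_le_norm (p k - p o) (v 1)
  by_contra! hlt
  nlinarith [norm_nonneg (v 0), norm_nonneg (v 1)]

lemma norm_two_le (h : IsGreedy p o v) : ‖v 2‖ ≤ ‖v 1‖ := by
  obtain ⟨k, hk⟩ := h.two_mem
  have h0 := h.one_max k
  have h1 : ⟪residual (v 0) 0 0 (p k - p o), v 2⟫_ℝ = ‖v 2‖ ^ 2 := by
    have : residual (v 0) 0 0 (p k - p o)
        = v 2 + (⟪p k - p o, v 1⟫_ℝ / ⟪v 1, v 1⟫_ℝ) • v 1 := by
      rw [hk]; simp [residual]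
    have h12 : ⟪v 1, v 2⟫_ℝ = 0 := h.orthogonal 1 2 (by decide)
    rw [this, inner_add_left, real_inner_smul_left, h12, real_inner_self_eq_norm_sq]; ring
  have h2 := real_inner_le_norm (residual (v 0) 0 0 (p k - p o)) (v 2)
  by_contra! hlt
  nlinarith [norm_nonneg (v 1), norm_nonneg (v 2)]

lemma abs_inner_le (h : IsGreedy p o v) (k : ι) (i : Fin 3) :
    |⟪p k - p o, v i⟫_ℝ| ≤ ‖v i‖ ^ 2 := by
  have key : ∀ {r w : Point}, ‖r‖ ≤ ‖w‖ → |⟪r, w⟫_ℝ| ≤ ‖w‖ ^ 2 := fun {r w} hr =>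
    (abs_real_inner_le_norm r w).trans (by nlinarith [norm_nonneg w])
  fin_cases i
  · have := h.zero_max k
    rw [residual_zero] at this
    exact key this
  · have h1 := key (h.one_max k)
    have h01 : ⟪v 0, v 1⟫_ℝ = 0 := h.orthogonal 0 1 (by decide)
    simp only [residual, smul_zero, sub_zero] at h1
    rw [inner_sub_left, real_inner_smul_left, h01, mul_zero, sub_zero] at h1
    exact h1
  · have h1 := key (h.two_max k)
    have h02 : ⟪v 0, v 2⟫_ℝ = 0 := h.orthogonal 0 2 (by decide)
    have h12 : ⟪v 1, v 2⟫_ℝ = 0 := h.orthogonal 1 2 (by decide)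
    simp only [residual, smul_zero, sub_zero] at h1
    rw [inner_sub_left, inner_sub_left, real_inner_smul_left, real_inner_smul_left, h02, h12,
      mul_zero, mul_zero, sub_zero, sub_zero] at h1
    exact h1

variable [Finite ι] in
/-- Each vector is a difference of two points up to a bounded combination of the preceding
vectors, which is why it bounds the width from below. -/
lemma isReference (h : IsGreedy p o v) : IsReference p v := by
  have h0 : ∀ d, |⟪d, v 0⟫_ℝ| ≤ width p d := by
    intro d
    obtain ⟨k, hk⟩ := h.zero_mem
    rw [hk, residual_zero, real_inner_comm]
    exact abs_inner_sub_le_width p d k o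
  have h1 : ∀ d, |⟪d, v 1⟫_ℝ| ≤ 2 * width p d := by
    intro d
    obtain ⟨k, hk⟩ := h.one_mem
    have hw := abs_inner_sub_le_width p d k o
    rw [real_inner_comm] at hw
    have hc := abs_div_inner_self_le (h.abs_inner_le k 0)
    set c := ⟪p k - p o, v 0⟫_ℝ / ⟪v 0, v 0⟫_ℝ with hcdef
    have e : ⟪d, v 1⟫_ℝ = ⟪d, p k - p o⟫_ℝ - c * ⟪d, v 0⟫_ℝ := by
      rw [← real_inner_smul_right, ← inner_sub_right, hk, hcdef]; simp [residual]
    rw [e]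
    refine (abs_sub _ _).trans ?_
    rw [abs_mul]
    nlinarith [h0 d, abs_nonneg c, abs_nonneg ⟪d, v 0⟫_ℝ]
  refine ⟨h.orthogonal, h.norm_one_le, h.norm_two_le, fun k l i => ?_, h0, h1, fun d => ?_⟩
  · have e : p k - p l = (p k - p o) - (p l - p o) := by abel
    rw [e, inner_sub_left]
    refine (abs_sub _ _).trans ?_
    linarith [h.abs_inner_le k i, h.abs_inner_le l i]
  · obtain ⟨k, hk⟩ := h.two_mem
    have hw := abs_inner_sub_le_width p d k o
    rw [real_inner_comm] at hw
    have hc := abs_div_inner_self_le (h.abs_inner_le k 0)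
    have hc' := abs_div_inner_self_le (h.abs_inner_le k 1)
    set c := ⟪p k - p o, v 0⟫_ℝ / ⟪v 0, v 0⟫_ℝ with hcdef
    set c' := ⟪p k - p o, v 1⟫_ℝ / ⟪v 1, v 1⟫_ℝ with hcdef'
    have e : ⟪d, v 2⟫_ℝ = ⟪d, p k - p o⟫_ℝ - c * ⟪d, v 0⟫_ℝ - c' * ⟪d, v 1⟫_ℝ := by
      rw [← real_inner_smul_right, ← real_inner_smul_right, ← inner_sub_right, ← inner_sub_right,
        hk, hcdef, hcdef']
      simp [residual]
    rw [e]
    refine (abs_sub _ _).trans ?_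
    have e2 := abs_sub ⟪d, p k - p o⟫_ℝ (c * ⟪d, v 0⟫_ℝ)
    rw [abs_mul] at e2 ⊢
    nlinarith [h0 d, h1 d, abs_nonneg c, abs_nonneg c', abs_nonneg ⟪d, v 0⟫_ℝ,
      abs_nonneg ⟪d, v 1⟫_ℝ]

/-- Even for coplanar points, nothing remains after the three projections. -/
lemma eq_sum_smul (h : IsGreedy p o v) (k : ι) :
    p k - p o = ∑ i, (⟪p k - p o, v i⟫_ℝ / ⟪v i, v i⟫_ℝ) • v i := by
  by_cases h2 : v 2 = 0
  · have h3 := h.two_max k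
    rw [h2, norm_zero, norm_le_zero_iff] at h3
    simp only [residual, smul_zero, sub_zero] at h3
    rw [Fin.sum_univ_three, h2, smul_zero, add_zero, ← sub_eq_zero, ← sub_sub]
    exact h3
  · have n2 := norm_pos_iff.2 h2
    have n1 := n2.trans_le h.norm_two_le
    have n0 := n1.trans_le h.norm_one_le
    have hv : ∀ i, v i ≠ 0 := by
      intro i
      rw [← norm_pos_iff]
      fin_cases i <;> assumption
    simp_rw [real_inner_self_eq_norm_sq]
    exact sum_inner_div_smul h.orthogonal hv (p k - p o)

end IsGreedy

/-- The box with edges `2 • v i` and centre `q`. -/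
noncomputable def centredBox (q : Point) (v : Fin 3 → Point)
    (hv : ∀ i j, i ≠ j → ⟪v i, v j⟫_ℝ = 0) : Box where
  corner := q - ∑ i, v i
  edge i := (2 : ℝ) • v i
  orthogonal i j hij := by simp [inner_smul_left, inner_smul_right, hv i j hij]

lemma vol_centredBox {q : Point} (hv : ∀ i j, i ≠ j → ⟪v i, v j⟫_ℝ = 0) :
    (centredBox q v hv).vol = 8 * ∏ i, ‖v i‖ := by
  simp only [Box.vol, centredBox, norm_smul, Fin.prod_univ_three, Real.norm_ofNat]
  ring

lemma IsGreedy.centredBox_bounds (h : IsGreedy p o v) :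
    (centredBox (p o) v h.orthogonal).Bounds (Set.range p) := by
  rintro _ ⟨k, rfl⟩
  refine ⟨fun i => (1 + ⟪p k - p o, v i⟫_ℝ / ⟪v i, v i⟫_ℝ) / 2, fun i => ?_, ?_⟩
  · have := abs_le.1 (abs_div_inner_self_le (h.abs_inner_le k i))
    constructor <;> linarith
  · have e := h.eq_sum_smul k
    rw [sub_eq_iff_eq_add'] at e
    conv_lhs => rw [e]
    simp only [centredBox, smul_smul]
    rw [sub_add_eq_add_sub, add_sub_assoc, ← Finset.sum_sub_distrib]
    congr 1
    refine Finset.sum_congr rfl fun i _ => ?_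
    rw [div_mul_cancel₀ _ (two_ne_zero), add_smul, one_smul, add_sub_cancel_left]

end Reference

/-! ### A three-parameter family of orthogonal frames -/

section Family

/-- The frames through which the search runs. For pairwise orthogonal `v i` whose squared norms
`A`, `B`, `C` satisfy `B = lam * A` and `C = mu * B`, the three vectors are pairwise orthogonal. The
parameters `s`, `t`, `r` are slopes measured in units of the shape of the box of the `v i`: bounded
parameters suffice for boxes of nearly minimal volume, however flat the point set is. -/
noncomputable def frame (v : Fin 3 → Point) (lam mu s t r : ℝ) : Fin 3 → Point :=
  ![(1 + t ^ 2 * mu + r * s * t * lam * mu) • v 0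
      + (-(t * s * mu + r * s ^ 2 * lam * mu + r)) • v 1 + (r * t - s) • v 2,
    (r * lam) • v 0 + (1 : ℝ) • v 1 + (-(t + r * s * lam)) • v 2,
    (s * lam * mu) • v 0 + (t * mu) • v 1 + (1 : ℝ) • v 2]

variable {v : Fin 3 → Point} (hv : ∀ i j, i ≠ j → ⟪v i, v j⟫_ℝ = 0)
include hv

lemma inner_comb (x y z x' y' z' : ℝ) :
    ⟪x • v 0 + y • v 1 + z • v 2, x' • v 0 + y' • v 1 + z' • v 2⟫_ℝ
      = x * x' * ‖v 0‖ ^ 2 + y * y' * ‖v 1‖ ^ 2 + z * z' * ‖v 2‖ ^ 2 := by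
  simp only [inner_add_left, inner_add_right, real_inner_smul_left, real_inner_smul_right,
    hv 0 1 (by decide), hv 0 2 (by decide), hv 1 0 (by decide), hv 1 2 (by decide),
    hv 2 0 (by decide), hv 2 1 (by decide), real_inner_self_eq_norm_sq]
  ring

variable {lam mu : ℝ} (hB : ‖v 1‖ ^ 2 = lam * ‖v 0‖ ^ 2) (hC : ‖v 2‖ ^ 2 = mu * ‖v 1‖ ^ 2)
include hB hC

lemma frame_orthogonal (s t r : ℝ) (i j : Fin 3) (hij : i ≠ j) :
    ⟪frame v lam mu s t r i, frame v lam mu s t r j⟫_ℝ = 0 := by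
  rw [hB] at hC
  have h01 : ⟪frame v lam mu s t r 0, frame v lam mu s t r 1⟫_ℝ = 0 := by
    simp only [frame, Matrix.cons_val]
    rw [inner_comb hv, hC, hB]; ring
  have h02 : ⟪frame v lam mu s t r 0, frame v lam mu s t r 2⟫_ℝ = 0 := by
    simp only [frame, Matrix.cons_val]
    rw [inner_comb hv, hC, hB]; ring
  have h12 : ⟪frame v lam mu s t r 1, frame v lam mu s t r 2⟫_ℝ = 0 := by
    simp only [frame, Matrix.cons_val]
    rw [inner_comb hv, hC, hB]; ring
  fin_cases i <;> fin_cases j <;> first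
    | exact absurd rfl hij
    | assumption
    | (rw [real_inner_comm]; assumption)

lemma norm_sq_frame_two (s t r : ℝ) :
    ‖frame v lam mu s t r 2‖ ^ 2 = ‖v 2‖ ^ 2 * (1 + t ^ 2 * mu + s ^ 2 * (lam * mu)) := by
  rw [← real_inner_self_eq_norm_sq (frame v lam mu s t r 2)]
  simp only [frame, Matrix.cons_val]
  rw [inner_comb hv, hC, hB]; ring

lemma norm_sq_frame_one (s t r : ℝ) : ‖frame v lam mu s t r 1‖ ^ 2
    = ‖v 1‖ ^ 2 * (1 + r ^ 2 * lam + (t + r * s * lam) ^ 2 * mu) := by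
  rw [← real_inner_self_eq_norm_sq (frame v lam mu s t r 1)]
  simp only [frame, Matrix.cons_val]
  rw [inner_comb hv, hC, hB]; ring

lemma norm_sq_frame_zero (s t r : ℝ) : ‖frame v lam mu s t r 0‖ ^ 2
    = ‖v 0‖ ^ 2 * ((1 + r ^ 2 * lam + (t + r * s * lam) ^ 2 * mu)
      * (1 + t ^ 2 * mu + s ^ 2 * (lam * mu))) := by
  rw [← real_inner_self_eq_norm_sq (frame v lam mu s t r 0)]
  simp only [frame, Matrix.cons_val]
  rw [inner_comb hv, hC, hB]; ring

lemma frame_ne_zero (hlam : 0 ≤ lam) (hmu : 0 ≤ mu) (h0 : ∀ i, v i ≠ 0) (s t r : ℝ) (i : Fin 3) :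
    frame v lam mu s t r i ≠ 0 := by
  have hG3 : 0 < 1 + t ^ 2 * mu + s ^ 2 * (lam * mu) := by positivity
  have hG2 : 0 < 1 + r ^ 2 * lam + (t + r * s * lam) ^ 2 * mu := by positivity
  have hn : ∀ i, 0 < ‖v i‖ ^ 2 := fun i => pow_pos (norm_pos_iff.2 (h0 i)) 2
  have : 0 < ‖frame v lam mu s t r i‖ ^ 2 := by
    fin_cases i
    · exact (norm_sq_frame_zero hv hB hC s t r).symm ▸ mul_pos (hn 0) (mul_pos hG2 hG3)
    · exact (norm_sq_frame_one hv hB hC s t r).symm ▸ mul_pos (hn 1) hG2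
    · exact (norm_sq_frame_two hv hB hC s t r).symm ▸ mul_pos (hn 2) hG3
  intro h
  rw [h] at this
  simp at this

lemma prod_norm_frame (hlam : 0 ≤ lam) (hmu : 0 ≤ mu) (s t r : ℝ) :
    ∏ i, ‖frame v lam mu s t r i‖ = (∏ i, ‖v i‖)
      * ((1 + r ^ 2 * lam + (t + r * s * lam) ^ 2 * mu)
      * (1 + t ^ 2 * mu + s ^ 2 * (lam * mu))) := by
  have hG3 : 0 ≤ 1 + t ^ 2 * mu + s ^ 2 * (lam * mu) := by positivity
  have hG2 : 0 ≤ 1 + r ^ 2 * lam + (t + r * s * lam) ^ 2 * mu := by positivity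
  have hpos : 0 ≤ ∏ i, ‖v i‖ := Finset.prod_nonneg fun i _ => norm_nonneg _
  rw [← sq_eq_sq₀ (Finset.prod_nonneg fun i _ => norm_nonneg _)
    (mul_nonneg hpos (mul_nonneg hG2 hG3)), ← Finset.prod_pow]
  rw [Fin.prod_univ_three, Fin.prod_univ_three, norm_sq_frame_zero hv hB hC,
    norm_sq_frame_one hv hB hC, norm_sq_frame_two hv hB hC]
  ring

end Family

/-! ### Bounded parameters for an optimal frame -/

section Optimal

/-- Up to a permutation, corresponding members of two orthonormal frames enclose an angle bounded
away from a right angle: the determinant of the matrix of inner products is `±1`, so one of its six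
terms has absolute value at least `1 / 6`. -/
lemma exists_perm_le_abs_inner (b e : OrthonormalBasis (Fin 3) ℝ Point) :
    ∃ π : Equiv.Perm (Fin 3), ∀ i, 1 / 6 ≤ |⟪b (π i), e i⟫_ℝ| := by
  obtain ⟨M, hM⟩ : ∃ M : Matrix (Fin 3) (Fin 3) ℝ, ∀ i j, M i j = ⟪b i, e j⟫_ℝ :=
    ⟨fun i j => ⟪b i, e j⟫_ℝ, fun _ _ => rfl⟩
  have hMM : M * M.transpose = 1 := by
    ext i j
    rw [Matrix.one_apply, ← b.inner_eq_ite, ← e.sum_inner_mul_inner (b i) (b j)]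
    simp only [Matrix.mul_apply, Matrix.transpose_apply, hM]
    exact Finset.sum_congr rfl fun k _ => by rw [real_inner_comm (b j)]
  have hdet : |M.det| = 1 := by
    have := congrArg Matrix.det hMM
    rw [Matrix.det_mul, Matrix.det_transpose, Matrix.det_one] at this
    rw [← sq, ← sq_abs] at this
    exact (pow_eq_one_iff_of_nonneg (abs_nonneg _) two_ne_zero).1 this
  have hsum : ∑ _π : Equiv.Perm (Fin 3), (1 / 6 : ℝ)
      ≤ ∑ π : Equiv.Perm (Fin 3), |∏ i, M (π i) i| := by
    have hcard : Fintype.card (Equiv.Perm (Fin 3)) = 6 := by decide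
    rw [Finset.sum_const, Finset.card_univ, hcard, Matrix.det_apply] at *
    calc (6 • (1 / 6) : ℝ) = 1 := by norm_num
      _ ≤ _ := hdet.symm.le
      _ ≤ _ := Finset.abs_sum_le_sum_abs _ _
      _ = _ := by
        refine Finset.sum_congr rfl fun π _ => ?_
        rcases Int.units_eq_one_or (Equiv.Perm.sign π) with h | h <;> simp [h]
  obtain ⟨π, -, hπ⟩ := Finset.exists_le_of_sum_le Finset.univ_nonempty hsum
  refine ⟨π, fun i => ?_⟩
  simp only [hM] at hπ
  have hle : ∀ i, |⟪b (π i), e i⟫_ℝ| ≤ 1 := fun i => by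
    refine (abs_real_inner_le_norm _ _).trans ?_
    simp
  rw [Finset.abs_prod, ← Finset.mul_prod_erase _ _ (Finset.mem_univ i)] at hπ
  refine hπ.trans (mul_le_of_le_one_right (abs_nonneg _) ?_)
  exact Finset.prod_le_one (fun j _ => abs_nonneg _) fun j _ => hle j

variable {ι : Type*} [Finite ι] {p : ι → Point} {v : Fin 3 → Point}

/-- An orthonormal frame, numbered such that its members are not nearly orthogonal to the
corresponding reference vectors, belongs to the family up to scaling, with bounded parameters, if
its box is not larger than the box with edges `2 • v i`. -/
lemma exists_frame_eq_smul [Nonempty ι] (h : IsReference p v) (h0 : ∀ i, v i ≠ 0) {lam mu : ℝ}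
    (hB : ‖v 1‖ ^ 2 = lam * ‖v 0‖ ^ 2) (hC : ‖v 2‖ ^ 2 = mu * ‖v 1‖ ^ 2)
    (b : OrthonormalBasis (Fin 3) ℝ Point) (hb : ∀ i, ‖v i‖ / 6 ≤ |⟪b i, v i⟫_ℝ|)
    (hvol : ∏ i, width p (b i) ≤ 8 * ∏ i, ‖v i‖) :
    ∃ s t r : ℝ, |s| ≤ 7000 ∧ |t| ≤ 7000 ∧ |r| ≤ 7000 ∧
      ∃ c : Fin 3 → ℝ, ∀ i, frame v lam mu s t r i = c i • b i := by
  have hn : ∀ i, 0 < ‖v i‖ := fun i => norm_pos_iff.2 (h0 i)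
  have hx : ∀ i, 0 < |⟪b i, v i⟫_ℝ| := fun i => (div_pos (hn i) (by norm_num)).trans_le (hb i)
  have hx' : ∀ i, ⟪b i, v i⟫_ℝ ≠ 0 := fun i => abs_pos.1 (hx i)
  have w0 : ‖v 0‖ / 6 ≤ width p (b 0) := (hb 0).trans (h.abs_inner_zero_le _)
  have w1 : ‖v 1‖ / 12 ≤ width p (b 1) := by
    have := (hb 1).trans (h.abs_inner_one_le _); linarith
  have w2 : ‖v 2‖ / 24 ≤ width p (b 2) := by
    have := (hb 2).trans (h.abs_inner_two_le _); linarith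
  rw [Fin.prod_univ_three, Fin.prod_univ_three] at hvol
  have n0 := hn 0
  have n1 := hn 1
  have n2 := hn 2
  -- upper bounds for two of the widths, from `hvol` and the lower bounds for the others
  have u2 : width p (b 2) ≤ 576 * ‖v 2‖ := by
    have h01 : ‖v 0‖ / 6 * (‖v 1‖ / 12) ≤ width p (b 0) * width p (b 1) :=
      mul_le_mul w0 w1 (by positivity) (width_nonneg p _)
    have := mul_le_mul_of_nonneg_right h01 (width_nonneg p (b 2))
    have h3 : ‖v 0‖ * ‖v 1‖ * width p (b 2) ≤ ‖v 0‖ * ‖v 1‖ * (576 * ‖v 2‖) := by linarith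
    exact le_of_mul_le_mul_left h3 (by positivity)
  have u1 : width p (b 1) ≤ 1152 * ‖v 1‖ := by
    have h01 : ‖v 0‖ / 6 * (‖v 2‖ / 24) ≤ width p (b 0) * width p (b 2) :=
      mul_le_mul w0 w2 (by positivity) (width_nonneg p _)
    have := mul_le_mul_of_nonneg_right h01 (width_nonneg p (b 1))
    have h3 : ‖v 0‖ * ‖v 2‖ * width p (b 1) ≤ ‖v 0‖ * ‖v 2‖ * (1152 * ‖v 1‖) := by linarith
    exact le_of_mul_le_mul_left h3 (by positivity)
  have exp : ∀ i, b i = (⟪b i, v 0⟫_ℝ / ‖v 0‖ ^ 2) • v 0 + (⟪b i, v 1⟫_ℝ / ‖v 1‖ ^ 2) • v 1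
      + (⟪b i, v 2⟫_ℝ / ‖v 2‖ ^ 2) • v 2 := fun i => by
    conv_lhs => rw [sum_inner_div_smul h.orthogonal h0 (b i)]
    rw [Fin.sum_univ_three]
  set s := ⟪b 2, v 0⟫_ℝ / ⟪b 2, v 2⟫_ℝ with hs
  set t := ⟪b 2, v 1⟫_ℝ / ⟪b 2, v 2⟫_ℝ with ht
  set r := ⟪b 1, v 0⟫_ℝ / ⟪b 1, v 1⟫_ℝ with hr
  have hf2 : frame v lam mu s t r 2 = (‖v 2‖ ^ 2 / ⟪b 2, v 2⟫_ℝ) • b 2 := by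
    rw [congrArg ((‖v 2‖ ^ 2 / ⟪b 2, v 2⟫_ℝ) • ·) (exp 2)]
    simp only [frame, Matrix.cons_val, smul_add, smul_smul]
    have e := hx' 2
    have hlam : lam = ‖v 1‖ ^ 2 / ‖v 0‖ ^ 2 := by rw [hB]; field_simp
    have hmu : mu = ‖v 2‖ ^ 2 / ‖v 1‖ ^ 2 := by rw [hC]; field_simp
    congr 1; congr 1
    · congr 1; rw [hlam, hmu, hs]; field_simp
    · congr 1; rw [hmu, ht]; field_simp
    · congr 1; field_simp
  have hf1 : frame v lam mu s t r 1 = (‖v 1‖ ^ 2 / ⟪b 1, v 1⟫_ℝ) • b 1 := by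
    have horth : ⟪b 1, b 2⟫_ℝ = 0 := b.orthonormal.2 (by decide)
    rw [exp 1, exp 2, inner_comb h.orthogonal] at horth
    rw [congrArg ((‖v 1‖ ^ 2 / ⟪b 1, v 1⟫_ℝ) • ·) (exp 1)]
    simp only [frame, Matrix.cons_val, smul_add, smul_smul]
    have e1 := hx' 1
    have e2 := hx' 2
    have hlam : lam = ‖v 1‖ ^ 2 / ‖v 0‖ ^ 2 := by rw [hB]; field_simp
    congr 1; congr 1
    · congr 1; rw [hlam, hr]; field_simp
    · congr 1; field_simp
    · congr 1; rw [hlam, hr, hs, ht]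
      field_simp at horth ⊢
      linear_combination (-1 : ℝ) * horth
  -- the remaining vector of the frame is orthogonal to `b 1` and `b 2`
  have hf0 : frame v lam mu s t r 0 = ⟪b 0, frame v lam mu s t r 0⟫_ℝ • b 0 := by
    have o := frame_orthogonal h.orthogonal hB hC s t r
    have o1 : ⟪b 1, frame v lam mu s t r 0⟫_ℝ = 0 := by
      have := o 1 0 (by decide)
      rw [hf1, real_inner_smul_left] at this
      exact (mul_eq_zero.1 this).resolve_left (div_ne_zero (by positivity) (hx' 1))
    have o2 : ⟪b 2, frame v lam mu s t r 0⟫_ℝ = 0 := by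
      have := o 2 0 (by decide)
      rw [hf2, real_inner_smul_left] at this
      exact (mul_eq_zero.1 this).resolve_left (div_ne_zero (by positivity) (hx' 2))
    conv_lhs => rw [← b.sum_repr' (frame v lam mu s t r 0)]
    rw [Fin.sum_univ_three, o1, o2]
    simp
  refine ⟨s, t, r, ?_, ?_, ?_, ![⟪b 0, frame v lam mu s t r 0⟫_ℝ,
    ‖v 1‖ ^ 2 / ⟪b 1, v 1⟫_ℝ, ‖v 2‖ ^ 2 / ⟪b 2, v 2⟫_ℝ], fun i => ?_⟩
  -- the largest of the three bounds is `2 * 576 * 6 = 1152 * 6 = 6912`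
  · rw [hs, abs_div, div_le_iff₀ (hx 2)]
    linarith [h.abs_inner_zero_le (b 2), hb 2]
  · rw [ht, abs_div, div_le_iff₀ (hx 2)]
    linarith [h.abs_inner_one_le (b 2), hb 2]
  · rw [hr, abs_div, div_le_iff₀ (hx 1)]
    linarith [h.abs_inner_zero_le (b 1), hb 1]
  · fin_cases i
    · exact hf0
    · exact hf1
    · exact hf2

end Optimal

/-! ### Perturbation of the parameters -/

section Perturbation

lemma abs_mul_sub_mul_le {x y x' y' M N a b : ℝ} (hx : |x| ≤ M) (hy : |y'| ≤ N)
    (hxx : |x' - x| ≤ a) (hyy : |y' - y| ≤ b) : |x' * y' - x * y| ≤ M * b + a * N := by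
  have e : x' * y' - x * y = x * (y' - y) + (x' - x) * y' := by ring
  rw [e]
  refine (abs_add_le _ _).trans ?_
  rw [abs_mul, abs_mul]
  exact add_le_add (mul_le_mul hx hyy (abs_nonneg _) ((abs_nonneg _).trans hx))
    (mul_le_mul hxx hy (abs_nonneg _) ((abs_nonneg _).trans hxx))

lemma abs_mul_le_of_unit {x c a : ℝ} (hx : |x| ≤ a) (h0 : 0 ≤ c) (h1 : c ≤ 1) : |x * c| ≤ a := by
  rw [abs_mul, abs_of_nonneg h0]
  exact (mul_le_of_le_one_right (abs_nonneg x) h1).trans hx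

variable {ι : Type*} [Finite ι] {p : ι → Point} {v : Fin 3 → Point}

lemma width_comb_le [Nonempty ι] (h : IsReference p v) (x y z : ℝ) :
    width p (x • v 0 + y • v 1 + z • v 2)
      ≤ 2 * (|x| * ‖v 0‖ ^ 2 + |y| * ‖v 1‖ ^ 2 + |z| * ‖v 2‖ ^ 2) := by
  refine width_le p fun k l => ?_
  simp only [inner_add_right, real_inner_smul_right]
  have key : ∀ (c : ℝ) i, c * ⟪p k - p l, v i⟫_ℝ ≤ |c| * (2 * ‖v i‖ ^ 2) := fun c i => by
    refine (le_abs_self _).trans ?_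
    rw [abs_mul]
    exact mul_le_mul_of_nonneg_left (h.abs_inner_sub_le k l i) (abs_nonneg c)
  linarith [key x 0, key y 1, key z 2]

lemma frame_sub_frame (lam mu s t r s' t' r' : ℝ) (i : Fin 3) :
    frame v lam mu s' t' r' i - frame v lam mu s t r i =
      (![(t' * t' - t * t) * mu + (r' * (s' * t') - r * (s * t)) * (lam * mu),
        (r' - r) * lam, (s' - s) * (lam * mu)] i : ℝ) • v 0
      + (![-((t' * s' - t * s) * mu + (r' * (s' * s') - r * (s * s)) * (lam * mu) + (r' - r)),
        0, (t' - t) * mu] i : ℝ) • v 1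
      + (![(r' * t' - r * t) - (s' - s), -((t' - t) + (r' * s' - r * s) * lam), 0] i : ℝ)
        • v 2 := by
  fin_cases i <;>
  · simp only [frame, Fin.zero_eta, Fin.mk_one, Fin.reduceFinMk, Matrix.cons_val]
    module

variable {lam mu s t r s' t' r' δ : ℝ} (hlam : 0 ≤ lam) (hlam1 : lam ≤ 1) (hmu : 0 ≤ mu)
  (hmu1 : mu ≤ 1) (hs : |s| ≤ 7000) (ht : |t| ≤ 7000) (hr : |r| ≤ 7000)
  (hs' : |s'| ≤ 7000) (ht' : |t'| ≤ 7000)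
  (hds : |s' - s| ≤ δ) (hdt : |t' - t| ≤ δ) (hdr : |r' - r| ≤ δ)
include hlam hlam1 hmu hmu1 hs ht hr hs' ht' hds hdt hdr

/-- The widths of the three frame vectors have orders of magnitude `‖v i‖ ^ 2`; the weights `lam`
and `mu` make each error of the same order. The factor `10 ^ 13` is a generous bound for the
Lipschitz constants of the coefficients when the parameters are bounded by `7000`. -/
lemma width_frame_le [Nonempty ι] (h : IsReference p v)
    (hB : ‖v 1‖ ^ 2 = lam * ‖v 0‖ ^ 2) (hC : ‖v 2‖ ^ 2 = mu * ‖v 1‖ ^ 2)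
    (hlow : ‖v 0‖ ^ 2 / 6 ≤ |⟪frame v lam mu s t r 0, v 0⟫_ℝ|) (i : Fin 3) :
    width p (frame v lam mu s' t' r' i)
      ≤ (1 + 10 ^ 13 * δ) * width p (frame v lam mu s t r i) := by
  have hδ : 0 ≤ δ := (abs_nonneg _).trans hds
  have hlm0 : 0 ≤ lam * mu := mul_nonneg hlam hmu
  have hlm1 : lam * mu ≤ 1 := mul_le_one₀ hlam1 hmu hmu1
  have hA : 0 ≤ ‖v 0‖ ^ 2 := sq_nonneg _
  have hB0 : 0 ≤ ‖v 1‖ ^ 2 := sq_nonneg _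
  have hC0 : 0 ≤ ‖v 2‖ ^ 2 := sq_nonneg _
  have hBA : ‖v 1‖ ^ 2 ≤ ‖v 0‖ ^ 2 := by rw [hB]; exact mul_le_of_le_one_left hA hlam1
  have hCB : ‖v 2‖ ^ 2 ≤ ‖v 1‖ ^ 2 := by rw [hC]; exact mul_le_of_le_one_left hB0 hmu1
  have hstep := width_le_add p (frame v lam mu s t r i) (frame v lam mu s' t' r' i)
  rw [frame_sub_frame] at hstep
  refine hstep.trans ?_
  have hw := width_nonneg p (frame v lam mu s t r i)
  suffices hsuff : width p
      ((![(t' * t' - t * t) * mu + (r' * (s' * t') - r * (s * t)) * (lam * mu),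
        (r' - r) * lam, (s' - s) * (lam * mu)] i : ℝ) • v 0
      + (![-((t' * s' - t * s) * mu + (r' * (s' * s') - r * (s * s)) * (lam * mu) + (r' - r)),
        0, (t' - t) * mu] i : ℝ) • v 1
      + (![(r' * t' - r * t) - (s' - s), -((t' - t) + (r' * s' - r * s) * lam), 0] i : ℝ) • v 2)
      ≤ 10 ^ 13 * δ * width p (frame v lam mu s t r i) by linarith
  refine (width_comb_le h _ _ _).trans ?_
  have hss : |s' * s'| ≤ 7000 * 7000 := by
    rw [abs_mul]; exact mul_le_mul hs' hs' (abs_nonneg _) (by norm_num)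
  have hst : |s' * t'| ≤ 7000 * 7000 := by
    rw [abs_mul]; exact mul_le_mul hs' ht' (abs_nonneg _) (by norm_num)
  have dtt := abs_mul_sub_mul_le ht ht' hdt hdt
  have dst := abs_mul_sub_mul_le hs ht' hds hdt
  have dss := abs_mul_sub_mul_le hs hs' hds hds
  have dts := abs_mul_sub_mul_le ht hs' hdt hds
  have drt := abs_mul_sub_mul_le hr ht' hdr hdt
  have drs := abs_mul_sub_mul_le hr hs' hdr hds
  have drst := abs_mul_sub_mul_le hr hst hdr dst
  have drss := abs_mul_sub_mul_le hr hss hdr dss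
  fin_cases i
  · have hw0 := hlow.trans (h.abs_inner_zero_le _)
    have c0 : |(t' * t' - t * t) * mu + (r' * (s' * t') - r * (s * t)) * (lam * mu)|
        ≤ 10 ^ 9 * δ := by
      refine (abs_add_le _ _).trans ?_
      linarith [abs_mul_le_of_unit dtt hmu hmu1, abs_mul_le_of_unit drst hlm0 hlm1]
    have c1 : |-((t' * s' - t * s) * mu + (r' * (s' * s') - r * (s * s)) * (lam * mu) + (r' - r))|
        ≤ 10 ^ 9 * δ := by
      rw [abs_neg]
      refine (abs_add_le _ _).trans ((add_le_add_left (abs_add_le _ _) _).trans ?_)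
      linarith [abs_mul_le_of_unit dts hmu hmu1, abs_mul_le_of_unit drss hlm0 hlm1]
    have c2 : |(r' * t' - r * t) - (s' - s)| ≤ 10 ^ 9 * δ := by
      refine (abs_sub _ _).trans ?_
      linarith
    simp only [Fin.zero_eta, Matrix.cons_val]
    have e0 := mul_le_mul_of_nonneg_right c0 hA
    have e1 := mul_le_mul c1 hBA hB0 (by positivity)
    have e2 := mul_le_mul c2 (hCB.trans hBA) hC0 (by positivity)
    have e3 := mul_le_mul_of_nonneg_left hw0 (by positivity : 0 ≤ 10 ^ 13 * δ)
    have e4 : 0 ≤ δ * ‖v 0‖ ^ 2 := mul_nonneg hδ hA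
    linarith
  · have hw1 : ‖v 1‖ ^ 2 / 2 ≤ width p (frame v lam mu s t r 1) := by
      have := h.abs_inner_one_le (frame v lam mu s t r 1)
      have e : ⟪frame v lam mu s t r 1, v 1⟫_ℝ = ‖v 1‖ ^ 2 := by
        have := inner_comb h.orthogonal (r * lam) 1 (-(t + r * s * lam)) 0 1 0
        simp only [frame, Matrix.cons_val]
        simpa using this
      rw [e, abs_of_nonneg hB0] at this
      linarith
    have c0 := mul_le_mul_of_nonneg_right hdr hB0
    have e0 : |(r' - r) * lam| * ‖v 0‖ ^ 2 = |r' - r| * ‖v 1‖ ^ 2 := by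
      rw [abs_mul, abs_of_nonneg hlam, hB]; ring
    have c2 : |-((t' - t) + (r' * s' - r * s) * lam)| ≤ 10 ^ 9 * δ := by
      rw [abs_neg]
      refine (abs_add_le _ _).trans ?_
      linarith [abs_mul_le_of_unit drs hlam hlam1]
    simp only [Fin.mk_one, Matrix.cons_val]
    rw [e0, abs_zero, zero_mul]
    have e2 := mul_le_mul c2 hCB hC0 (by positivity)
    have e3 := mul_le_mul_of_nonneg_left hw1 (by positivity : 0 ≤ 10 ^ 13 * δ)
    have e4 : 0 ≤ δ * ‖v 1‖ ^ 2 := mul_nonneg hδ hB0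
    linarith
  · have hw2 : ‖v 2‖ ^ 2 / 4 ≤ width p (frame v lam mu s t r 2) := by
      have := h.abs_inner_two_le (frame v lam mu s t r 2)
      have e : ⟪frame v lam mu s t r 2, v 2⟫_ℝ = ‖v 2‖ ^ 2 := by
        have := inner_comb h.orthogonal (s * lam * mu) (t * mu) 1 0 0 1
        simp only [frame, Matrix.cons_val]
        simpa using this
      rw [e, abs_of_nonneg hC0] at this
      linarith
    have c0 := mul_le_mul_of_nonneg_right hds hC0
    have c1 := mul_le_mul_of_nonneg_right hdt hC0
    have e0 : |(s' - s) * (lam * mu)| * ‖v 0‖ ^ 2 = |s' - s| * ‖v 2‖ ^ 2 := by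
      rw [abs_mul, abs_of_nonneg hlm0, hC, hB]; ring
    have e1 : |(t' - t) * mu| * ‖v 1‖ ^ 2 = |t' - t| * ‖v 2‖ ^ 2 := by
      rw [abs_mul, abs_of_nonneg hmu, hC]; ring
    simp only [Fin.reduceFinMk, Matrix.cons_val]
    rw [e0, e1, abs_zero, zero_mul]
    have e3 := mul_le_mul_of_nonneg_left hw2 (by positivity : 0 ≤ 10 ^ 13 * δ)
    have e4 : 0 ≤ δ * ‖v 2‖ ^ 2 := mul_nonneg hδ hC0
    linarith

/-- The two factors of `prod_norm_frame` are at least `1`, so that a small absolute change of each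
is a small relative change. -/
lemma prod_norm_frame_ge (hr' : |r'| ≤ 7000) (hv : ∀ i j, i ≠ j → ⟪v i, v j⟫_ℝ = 0)
    (hB : ‖v 1‖ ^ 2 = lam * ‖v 0‖ ^ 2) (hC : ‖v 2‖ ^ 2 = mu * ‖v 1‖ ^ 2)
    (hδ1 : 10 ^ 13 * δ ≤ 1) :
    (1 - 10 ^ 13 * δ) ^ 2 * ∏ i, ‖frame v lam mu s t r i‖
      ≤ ∏ i, ‖frame v lam mu s' t' r' i‖ := by
  have hδ : 0 ≤ δ := (abs_nonneg _).trans hds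
  have hlm0 : 0 ≤ lam * mu := mul_nonneg hlam hmu
  have hlm1 : lam * mu ≤ 1 := mul_le_one₀ hlam1 hmu hmu1
  have dtt := abs_mul_sub_mul_le ht ht' hdt hdt
  have dss := abs_mul_sub_mul_le hs hs' hds hds
  have drr := abs_mul_sub_mul_le hr hr' hdr hdr
  have drs := abs_mul_sub_mul_le hr hs' hdr hds
  have hrs : ∀ {x y : ℝ}, |x| ≤ 7000 → |y| ≤ 7000 → |x * y| ≤ 7000 * 7000 := fun hx hy => by
    rw [abs_mul]; exact mul_le_mul hx hy (abs_nonneg _) (by norm_num)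
  have hf : |t + r * s * lam| ≤ 7000 + 7000 * 7000 :=
    (abs_add_le _ _).trans (add_le_add ht (abs_mul_le_of_unit (hrs hr hs) hlam hlam1))
  have hf' : |t' + r' * s' * lam| ≤ 7000 + 7000 * 7000 :=
    (abs_add_le _ _).trans (add_le_add ht' (abs_mul_le_of_unit (hrs hr' hs') hlam hlam1))
  have df : |(t' + r' * s' * lam) - (t + r * s * lam)| ≤ 14001 * δ := by
    have e : (t' + r' * s' * lam) - (t + r * s * lam)
        = (t' - t) + (r' * s' - r * s) * lam := by ring
    rw [e]
    refine (abs_add_le _ _).trans ?_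
    linarith [abs_mul_le_of_unit drs hlam hlam1]
  have dff := abs_mul_sub_mul_le hf hf' df df
  set g2 := 1 + r ^ 2 * lam + (t + r * s * lam) ^ 2 * mu with hg2
  set g3 := 1 + t ^ 2 * mu + s ^ 2 * (lam * mu) with hg3
  have hg2' : (1 - 10 ^ 13 * δ) * g2
      ≤ 1 + r' ^ 2 * lam + (t' + r' * s' * lam) ^ 2 * mu := by
    have e := (abs_le.1 (abs_mul_le_of_unit drr hlam hlam1)).1
    have e' := (abs_le.1 (abs_mul_le_of_unit dff hmu hmu1)).1
    have : 1 ≤ g2 := by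
      have : 0 ≤ r ^ 2 * lam + (t + r * s * lam) ^ 2 * mu := by positivity
      linarith
    have := mul_le_mul_of_nonneg_left this (by positivity : 0 ≤ 10 ^ 13 * δ)
    linarith
  have hg3' : (1 - 10 ^ 13 * δ) * g3 ≤ 1 + t' ^ 2 * mu + s' ^ 2 * (lam * mu) := by
    have e := (abs_le.1 (abs_mul_le_of_unit dtt hmu hmu1)).1
    have e' := (abs_le.1 (abs_mul_le_of_unit dss hlm0 hlm1)).1
    have : 1 ≤ g3 := by
      have : 0 ≤ t ^ 2 * mu + s ^ 2 * (lam * mu) := by positivity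
      linarith
    have := mul_le_mul_of_nonneg_left this (by positivity : 0 ≤ 10 ^ 13 * δ)
    linarith
  rw [prod_norm_frame hv hB hC hlam hmu, prod_norm_frame hv hB hC hlam hmu, ← hg2, ← hg3]
  have hpos : 0 ≤ ∏ i, ‖v i‖ := Finset.prod_nonneg fun i _ => norm_nonneg _
  have hg30 : 0 ≤ g3 := by positivity
  have h1 : 0 ≤ 1 - 10 ^ 13 * δ := by linarith
  calc (1 - 10 ^ 13 * δ) ^ 2 * ((∏ i, ‖v i‖) * (g2 * g3))
      = (∏ i, ‖v i‖) * (((1 - 10 ^ 13 * δ) * g2) * ((1 - 10 ^ 13 * δ) * g3)) := by ring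
    _ ≤ _ := mul_le_mul_of_nonneg_left
        (mul_le_mul hg2' hg3' (mul_nonneg h1 hg30) (by positivity)) hpos

end Perturbation

section Approximation

variable {ι : Type*} [Finite ι] [Nonempty ι] {p : ι → Point} {v : Fin 3 → Point}

/-- Some parameters are such that every frame with nearby parameters gives a box that is larger than
the box of the given orthonormal frame by a factor of at most `1 + ε`. -/
theorem exists_good_parameters (h : IsReference p v) (h0 : ∀ i, v i ≠ 0) {lam mu : ℝ}
    (hB : ‖v 1‖ ^ 2 = lam * ‖v 0‖ ^ 2) (hC : ‖v 2‖ ^ 2 = mu * ‖v 1‖ ^ 2)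
    {u : Fin 3 → Point} (hu : Orthonormal ℝ u)
    (hvol : ∏ i, width p (u i) ≤ 8 * ∏ i, ‖v i‖) {ε : ℝ} (hε : 0 < ε) (hε1 : ε ≤ 1) :
    ∃ s t r : ℝ, |s| ≤ 7000 ∧ |t| ≤ 7000 ∧ |r| ≤ 7000 ∧ ∀ s' t' r' : ℝ,
      |s'| ≤ 7000 → |t'| ≤ 7000 → |r'| ≤ 7000 → |s' - s| ≤ ε / (2 * 10 ^ 14) →
      |t' - t| ≤ ε / (2 * 10 ^ 14) → |r' - r| ≤ ε / (2 * 10 ^ 14) →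
      ∏ i, width p (frame v lam mu s' t' r' i) / ‖frame v lam mu s' t' r' i‖
        ≤ (1 + ε) * ∏ i, width p (u i) := by
  have hn : ∀ i, 0 < ‖v i‖ := fun i => norm_pos_iff.2 (h0 i)
  have n0 := hn 0
  have n1 := hn 1
  have n2 := hn 2
  have hlame : lam = ‖v 1‖ ^ 2 / ‖v 0‖ ^ 2 := by rw [hB]; field_simp
  have hmue : mu = ‖v 2‖ ^ 2 / ‖v 1‖ ^ 2 := by rw [hC]; field_simp
  have hlam : 0 ≤ lam := by rw [hlame]; positivity
  have hmu : 0 ≤ mu := by rw [hmue]; positivity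
  have hlam1 : lam ≤ 1 := by
    rw [hlame]
    exact div_le_one_of_le₀ (pow_le_pow_left₀ n1.le h.norm_one_le 2) (sq_nonneg _)
  have hmu1 : mu ≤ 1 := by
    rw [hmue]
    exact div_le_one_of_le₀ (pow_le_pow_left₀ n2.le h.norm_two_le 2) (sq_nonneg _)
  obtain ⟨b, hb⟩ := exists_orthonormalBasis_eq_norm_smul fun i j hij => hu.2 hij
  obtain ⟨e, he⟩ := exists_orthonormalBasis_eq_norm_smul h.orthogonal
  obtain ⟨π, hπ⟩ := exists_perm_le_abs_inner b e
  -- the members of `u`, renumbered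
  have hub : ∀ i, u i = b i := fun i => by
    conv_lhs => rw [hb i, hu.1 i, one_smul]
  set b' := b.reindex π.symm with hb'
  have hprod : ∏ i, width p (u i) = ∏ i, width p (b' i) := by
    rw [← Equiv.prod_comp π fun i => width p (u i)]
    refine Finset.prod_congr rfl fun i _ => ?_
    rw [hub, hb', OrthonormalBasis.reindex_apply, Equiv.symm_symm]
  have hinner : ∀ i, ‖v i‖ / 6 ≤ |⟪b' i, v i⟫_ℝ| := fun i => by
    have : ⟪b' i, v i⟫_ℝ = ‖v i‖ * ⟪b (π i), e i⟫_ℝ := by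
      rw [hb', OrthonormalBasis.reindex_apply, Equiv.symm_symm]
      conv_lhs => rw [he i, real_inner_smul_right]
    rw [this, abs_mul, abs_of_pos (hn i)]
    have := mul_le_mul_of_nonneg_left (hπ i) (hn i).le
    linarith
  rw [hprod] at hvol ⊢
  obtain ⟨s, t, r, hs, ht, hr, c, hc⟩ := exists_frame_eq_smul h h0 hB hC b' hinner hvol
  refine ⟨s, t, r, hs, ht, hr, fun s' t' r' hs' ht' hr' hds hdt hdr => ?_⟩
  have hnorm : ∀ i, ‖frame v lam mu s t r i‖ = |c i| := fun i => by
    rw [hc i, norm_smul, b'.orthonormal.1 i, mul_one, Real.norm_eq_abs]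
  have hlow : ‖v 0‖ ^ 2 / 6 ≤ |⟪frame v lam mu s t r 0, v 0⟫_ℝ| := by
    have h1 : ‖v 0‖ ≤ |c 0| := by
      rw [← hnorm, ← pow_le_pow_iff_left₀ n0.le (norm_nonneg _) two_ne_zero,
        norm_sq_frame_zero h.orthogonal hB hC]
      refine le_mul_of_one_le_right (sq_nonneg _) (one_le_mul_of_one_le_of_one_le ?_ ?_)
      · rw [add_assoc]
        exact le_add_of_nonneg_right (by positivity)
      · rw [add_assoc]
        exact le_add_of_nonneg_right (by positivity)
    rw [hc 0, real_inner_smul_left, abs_mul]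
    have := mul_le_mul h1 (hinner 0) (by positivity) (abs_nonneg _)
    linarith
  -- with this step, five factors within `ε / 20` of `1` cost at most a factor `1 + ε`
  generalize hδ : ε / (2 * 10 ^ 14) = δ at hds hdt hdr
  have hηε : 10 ^ 13 * δ = ε / 20 := by rw [← hδ]; ring
  have hN := prod_norm_frame_ge hlam hlam1 hmu hmu1 hs ht hr hs' ht' hds hdt hdr hr'
    h.orthogonal hB hC (by linarith)
  have hN' : 0 ≤ 1 + 10 ^ 13 * δ := by linarith
  have hW : ∏ i, width p (frame v lam mu s' t' r' i)
      ≤ (1 + 10 ^ 13 * δ) ^ 3 * ((∏ i, ‖frame v lam mu s t r i‖) * ∏ i, width p (b' i)) := by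
    have : (1 + 10 ^ 13 * δ) ^ 3 * ((∏ i, ‖frame v lam mu s t r i‖) * ∏ i, width p (b' i))
        = ∏ i, (1 + 10 ^ 13 * δ) * (‖frame v lam mu s t r i‖ * width p (b' i)) := by
      rw [Finset.prod_mul_distrib, Finset.prod_mul_distrib, Finset.prod_const]
      simp
    rw [this]
    refine Finset.prod_le_prod (fun i _ => width_nonneg p _) fun i _ => ?_
    refine (width_frame_le hlam hlam1 hmu hmu1 hs ht hr hs' ht' hds hdt hdr h hB hC hlow
      i).trans (mul_le_mul_of_nonneg_left ?_ hN')
    rw [hnorm, hc i]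
    exact width_smul_le p _ _
  set N := ∏ i, ‖frame v lam mu s t r i‖
  set W := ∏ i, width p (b' i)
  have hNpos : 0 ≤ N := Finset.prod_nonneg fun i _ => norm_nonneg _
  have hWpos : 0 ≤ W := Finset.prod_nonneg fun i _ => width_nonneg p _
  have hfac : (1 + 10 ^ 13 * δ) ^ 3 ≤ (1 + ε) * (1 - 10 ^ 13 * δ) ^ 2 := by
    rw [hηε]
    nlinarith [mul_pos hε hε, mul_pos (mul_pos hε hε) hε]
  rw [Finset.prod_div_distrib]
  refine div_le_of_le_mul₀ (Finset.prod_nonneg fun i _ => norm_nonneg _)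
    (mul_nonneg (by linarith) hWpos) (hW.trans ?_)
  have hfac' := mul_le_mul_of_nonneg_right hfac (mul_nonneg hNpos hWpos)
  have hN'' := mul_le_mul_of_nonneg_left hN (mul_nonneg (by linarith : 0 ≤ 1 + ε) hWpos)
  refine hfac'.trans (le_trans (le_of_eq ?_) hN'')
  ring

end Approximation

end MinBox

namespace RealRAM

open scoped InnerProductSpace

/-! ### Total correctness of programs -/

section Runs

/-- Started in `s`, the program `P` halts within `T` time units in a state that satisfies `Q`. -/
def Runs (P : Program) (s : State) (T : ℕ) (Q : State → Prop) : Prop :=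
  ∃ t s', Exec P s t s' ∧ t ≤ T ∧ Q s'

lemma Runs.mono {P : Program} {s : State} {T T' : ℕ} {Q Q' : State → Prop}
    (h : Runs P s T Q) (hT : T ≤ T') (hQ : ∀ s', Q s' → Q' s') : Runs P s T' Q' := by
  obtain ⟨t, s', he, ht, hs⟩ := h
  exact ⟨t, s', he, ht.trans hT, hQ s' hs⟩

lemma Runs.seq {P P' : Program} {s : State} {T T' : ℕ} {Q Q' : State → Prop}
    (h : Runs P s T Q) (h' : ∀ s', Q s' → Runs P' s' T' Q') :
    Runs (.seq P P') s (T + T') Q' := by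
  obtain ⟨t, s', he, ht, hs⟩ := h
  obtain ⟨t', s'', he', ht', hs'⟩ := h' s' hs
  exact ⟨t + t', s'', .seq he he', add_le_add ht ht', hs'⟩

lemma Runs.branch {b : Test} {P P' : Program} {s : State} {T : ℕ} {Q : State → Prop}
    (h : b.eval s → Runs P s T Q) (h' : ¬ b.eval s → Runs P' s T Q) :
    Runs (.branch b P P') s (b.cost + 1 + T) Q := by
  by_cases hb : b.eval s
  · obtain ⟨t, s', he, ht, hs⟩ := h hb
    exact ⟨_, s', .branchTrue hb he, by omega, hs⟩
  · obtain ⟨t, s', he, ht, hs⟩ := h' hb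
    exact ⟨_, s', .branchFalse hb he, by omega, hs⟩

/-- Programs without loops. -/
def Program.LoopFree : Program → Prop
  | .seq P Q => P.LoopFree ∧ Q.LoopFree
  | .branch _ P Q => P.LoopFree ∧ Q.LoopFree
  | .loop _ _ => False
  | _ => True

/-- An upper bound on the running time of a program without loops. -/
def Program.time : Program → ℕ
  | .skip => 1
  | .setInt _ e => e.cost + 1
  | .setReal _ e => e.cost + 1
  | .putInt _ i e => i.cost + e.cost + 1
  | .putReal _ i e => i.cost + e.cost + 1
  | .seq P Q => P.time + Q.time
  | .branch b P Q => b.cost + 1 + (P.time + Q.time)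
  | .loop _ _ => 0

open Classical in
/-- The final state of a program without loops. -/
noncomputable def Program.run : Program → State → State
  | .skip, s => s
  | .setInt x e, s => s.setInt x (e.eval s)
  | .setReal x e, s => s.setReal x (e.eval s)
  | .putInt a i e, s => s.putInt a (i.eval s) (e.eval s)
  | .putReal a i e, s => s.putReal a (i.eval s) (e.eval s)
  | .seq P Q, s => Q.run (P.run s)
  | .branch b P Q, s => if b.eval s then P.run s else Q.run s
  | .loop _ _, s => s

lemma Program.run_branch_of_true {b : Test} {s : State} (h : b.eval s) (P Q : Program) :
    (Program.branch b P Q).run s = P.run s := if_pos h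

lemma Program.run_branch_of_false {b : Test} {s : State} (h : ¬ b.eval s) (P Q : Program) :
    (Program.branch b P Q).run s = Q.run s := if_neg h

lemma Program.LoopFree.runs {P : Program} (h : P.LoopFree) (s : State) :
    Runs P s P.time (· = P.run s) := by
  induction P generalizing s with
  | skip => exact ⟨_, _, .skip s, le_rfl, rfl⟩
  | setInt x e => exact ⟨_, _, .setInt s x e, le_rfl, rfl⟩
  | setReal x e => exact ⟨_, _, .setReal s x e, le_rfl, rfl⟩
  | putInt a i e => exact ⟨_, _, .putInt s a i e, le_rfl, rfl⟩
  | putReal a i e => exact ⟨_, _, .putReal s a i e, le_rfl, rfl⟩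
  | seq P Q ihP ihQ =>
    refine (ihP h.1 s).seq fun s' hs' => ?_
    subst hs'
    exact ihQ h.2 _
  | branch b P Q ihP ihQ =>
    by_cases hb : b.eval s
    · obtain ⟨t, s', he, ht, hs⟩ := ihP h.1 s
      refine ⟨_, s', .branchTrue hb he, ?_, hs.trans (Program.run_branch_of_true hb P Q).symm⟩
      simp only [Program.time]
      omega
    · obtain ⟨t, s', he, ht, hs⟩ := ihQ h.2 s
      refine ⟨_, s', .branchFalse hb he, ?_, hs.trans (Program.run_branch_of_false hb P Q).symm⟩
      simp only [Program.time]
      omega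
  | loop b P => exact h.elim

lemma Program.LoopFree.runs_of {P : Program} (h : P.LoopFree) {s : State} {Q : State → Prop}
    (hQ : Q (P.run s)) : Runs P s P.time Q :=
  (h.runs s).mono le_rfl fun _ hs => hs ▸ hQ

/-- The real variables to which a program assigns. -/
def Program.realWrites : Program → List ℕ
  | .setReal x _ => [x]
  | .seq P Q => P.realWrites ++ Q.realWrites
  | .branch _ P Q => P.realWrites ++ Q.realWrites
  | .loop _ P => P.realWrites
  | _ => []

/-- The integer variables to which a program assigns. -/
def Program.intWrites : Program → List ℕ
  | .setInt x _ => [x]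
  | .seq P Q => P.intWrites ++ Q.intWrites
  | .branch _ P Q => P.intWrites ++ Q.intWrites
  | .loop _ P => P.intWrites
  | _ => []

/-- The real arrays to which a program assigns. -/
def Program.arrWrites : Program → List ℕ
  | .putReal a _ _ => [a]
  | .seq P Q => P.arrWrites ++ Q.arrWrites
  | .branch _ P Q => P.arrWrites ++ Q.arrWrites
  | .loop _ P => P.arrWrites
  | _ => []

/-- The states `s` and `s'` agree except on what the program `P` assigns to. -/
structure Program.Frame (P : Program) (s s' : State) : Prop where
  realVar : ∀ x, x ∉ P.realWrites → s'.realVar x = s.realVar x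
  intVar : ∀ x, x ∉ P.intWrites → s'.intVar x = s.intVar x
  realArr : ∀ a, a ∉ P.arrWrites → s'.realArr a = s.realArr a

lemma Exec.frame {P : Program} {s s' : State} {t : ℕ} (h : Exec P s t s') : P.Frame s s' := by
  induction h with
  | skip s => exact ⟨fun _ _ => rfl, fun _ _ => rfl, fun _ _ => rfl⟩
  | setInt s x e =>
    refine ⟨fun _ _ => rfl, fun y hy => ?_, fun _ _ => rfl⟩
    exact Function.update_of_ne (by simpa [Program.intWrites] using hy) _ _
  | setReal s x e =>
    refine ⟨fun y hy => ?_, fun _ _ => rfl, fun _ _ => rfl⟩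
    exact Function.update_of_ne (by simpa [Program.realWrites] using hy) _ _
  | putInt s a i e => exact ⟨fun _ _ => rfl, fun _ _ => rfl, fun _ _ => rfl⟩
  | putReal s a i e =>
    refine ⟨fun _ _ => rfl, fun _ _ => rfl, fun y hy => ?_⟩
    exact Function.update_of_ne (by simpa [Program.arrWrites] using hy) _ _
  | seq _ _ h1 h2 =>
    refine ⟨fun x hx => ?_, fun x hx => ?_, fun x hx => ?_⟩
    · simp only [Program.realWrites, List.mem_append, not_or] at hx
      rw [h2.realVar x hx.2, h1.realVar x hx.1]
    · simp only [Program.intWrites, List.mem_append, not_or] at hx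
      rw [h2.intVar x hx.2, h1.intVar x hx.1]
    · simp only [Program.arrWrites, List.mem_append, not_or] at hx
      rw [h2.realArr x hx.2, h1.realArr x hx.1]
  | branchTrue _ _ h =>
    refine ⟨fun x hx => ?_, fun x hx => ?_, fun x hx => ?_⟩
    · simp only [Program.realWrites, List.mem_append, not_or] at hx
      exact h.realVar x hx.1
    · simp only [Program.intWrites, List.mem_append, not_or] at hx
      exact h.intVar x hx.1
    · simp only [Program.arrWrites, List.mem_append, not_or] at hx
      exact h.realArr x hx.1
  | branchFalse _ _ h =>
    refine ⟨fun x hx => ?_, fun x hx => ?_, fun x hx => ?_⟩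
    · simp only [Program.realWrites, List.mem_append, not_or] at hx
      exact h.realVar x hx.2
    · simp only [Program.intWrites, List.mem_append, not_or] at hx
      exact h.intVar x hx.2
    · simp only [Program.arrWrites, List.mem_append, not_or] at hx
      exact h.realArr x hx.2
  | loopDone _ => exact ⟨fun _ _ => rfl, fun _ _ => rfl, fun _ _ => rfl⟩
  | loopStep _ _ _ h1 h2 =>
    refine ⟨fun x hx => ?_, fun x hx => ?_, fun x hx => ?_⟩
    · rw [h2.realVar x hx, h1.realVar x hx]
    · rw [h2.intVar x hx, h1.intVar x hx]
    · rw [h2.realArr x hx, h1.realArr x hx]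

lemma Runs.frame {P : Program} {s : State} {T : ℕ} {Q : State → Prop} (h : Runs P s T Q) :
    Runs P s T fun s' => Q s' ∧ P.Frame s s' := by
  obtain ⟨t, s', he, ht, hs⟩ := h
  exact ⟨t, s', he, ht, hs, he.frame⟩

end Runs

/-! ### Vectors in memory -/

section Vectors

/-- The vector stored in three consecutive real variables. -/
noncomputable def State.vec (s : State) (x : ℕ) : Point :=
  WithLp.toLp 2 fun j : Fin 3 => s.realVar (x + j)

/-- The state after assignment of a vector to three consecutive real variables. -/
noncomputable def State.setVec (s : State) (x : ℕ) (w : Point) : State :=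
  ((s.setReal x (w 0)).setReal (x + 1) (w 1)).setReal (x + 2) (w 2)

section Lemmas

variable (s : State) (x y : ℕ) (v : ℝ) (w : Point) (k : ℕ)

@[simp] lemma State.realVar_setReal :
    (s.setReal x v).realVar y = if y = x then v else s.realVar y := by
  simp [State.setReal, Function.update_apply]

@[simp] lemma State.intVar_setReal : (s.setReal x v).intVar = s.intVar := rfl

@[simp] lemma State.vector_setReal : (s.setReal x v).vector k = s.vector k := rfl

@[simp] lemma State.intVar_setVec : (s.setVec x w).intVar = s.intVar := rfl

@[simp] lemma State.vector_setVec : (s.setVec x w).vector k = s.vector k := rfl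

@[simp] lemma State.intVar_setInt (k : ℕ) :
    (s.setInt x k).intVar y = if y = x then k else s.intVar y := by
  simp [State.setInt, Function.update_apply]

@[simp] lemma State.realVar_setInt (k : ℕ) : (s.setInt x k).realVar = s.realVar := rfl

@[simp] lemma State.vec_setInt (k : ℕ) : (s.setInt x k).vec y = s.vec y := rfl

@[simp] lemma State.realVar_putReal (i : ℕ) : (s.putReal x i v).realVar = s.realVar := rfl

@[simp] lemma State.realArr_putReal (i : ℕ) : (s.putReal x i v).realArr y k
    = if y = x ∧ k = i then v else s.realArr y k := by
  by_cases h : y = x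
  · subst h
    simp [State.putReal, Function.update_apply]
  · simp [State.putReal, h]

@[simp] lemma State.vec_setVec_self : (s.setVec x w).vec x = w := by
  ext j
  fin_cases j <;> simp [State.vec, State.setVec]

variable {x y}

lemma State.vec_setReal (h : x < y ∨ y + 3 ≤ x) : (s.setReal x v).vec y = s.vec y := by
  ext j
  have := j.2
  have hne : y + (j : ℕ) ≠ x := by omega
  simp [State.vec, hne]

lemma State.vec_setVec (h : x + 3 ≤ y ∨ y + 3 ≤ x) : (s.setVec x w).vec y = s.vec y := by
  simp only [State.setVec]
  rw [State.vec_setReal _ _ (by omega), State.vec_setReal _ _ (by omega),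
    State.vec_setReal _ _ (by omega)]

lemma State.realVar_setVec (h : y < x ∨ x + 3 ≤ y) :
    (s.setVec x w).realVar y = s.realVar y := by
  have h0 : y ≠ x := by omega
  have h1 : y ≠ x + 1 := by omega
  have h2 : y ≠ x + 2 := by omega
  simp [State.setVec, h0, h1, h2]

variable {s} in
lemma Program.Frame.vec {P : Program} {s' : State} (h : P.Frame s s')
    (h0 : x ∉ P.realWrites ∧ x + 1 ∉ P.realWrites ∧ x + 2 ∉ P.realWrites) :
    s'.vec x = s.vec x := by
  ext j
  fin_cases j
  · exact h.realVar _ h0.1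
  · exact h.realVar _ h0.2.1
  · exact h.realVar _ h0.2.2

end Lemmas

/-- The real variables that occur in an expression. -/
def RExp.vars : RExp → List ℕ
  | .const _ => []
  | .var x => [x]
  | .get _ _ => []
  | .add e f => e.vars ++ f.vars
  | .sub e f => e.vars ++ f.vars
  | .mul e f => e.vars ++ f.vars
  | .div e f => e.vars ++ f.vars

lemma IExp.eval_setReal (s : State) (x : ℕ) (v : ℝ) (e : IExp) :
    e.eval (s.setReal x v) = e.eval s := by
  induction e with
  | const k => rfl
  | var x => rfl
  | get a i ih => simp only [IExp.eval, ih]; rfl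
  | add e f he hf => simp only [IExp.eval, he, hf]
  | sub e f he hf => simp only [IExp.eval, he, hf]

lemma RExp.eval_setReal {s : State} {x : ℕ} {v : ℝ} {e : RExp} (h : x ∉ e.vars) :
    e.eval (s.setReal x v) = e.eval s := by
  induction e with
  | const k => rfl
  | var y =>
    have : y ≠ x := by simpa [RExp.vars, eq_comm] using h
    simp [RExp.eval, this]
  | get a i => simp only [RExp.eval, IExp.eval_setReal]; rfl
  | add e f he hf | sub e f he hf | mul e f he hf | div e f he hf =>
    simp only [RExp.vars, List.mem_append, not_or] at h
    simp only [RExp.eval, he h.1, hf h.2]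

instance : Add RExp := ⟨.add⟩

instance : Sub RExp := ⟨.sub⟩

instance : Mul RExp := ⟨.mul⟩

instance : Div RExp := ⟨.div⟩

namespace RExp

variable (s : State) (e f : RExp)

@[simp] lemma eval_add : (e + f).eval s = e.eval s + f.eval s := rfl

@[simp] lemma eval_sub : (e - f).eval s = e.eval s - f.eval s := rfl

@[simp] lemma eval_mul : (e * f).eval s = e.eval s * f.eval s := rfl

@[simp] lemma eval_div : (e / f).eval s = e.eval s / f.eval s := rfl

@[simp] lemma eval_const (q : ℚ) : (const q).eval s = q := rfl

@[simp] lemma eval_var (x : ℕ) : (var x).eval s = s.realVar x := rfl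

end RExp

/-- Vector expressions, by coordinates. Sums, differences and scalar multiples are those of
functions. -/
abbrev VExp : Type := Fin 3 → RExp

namespace VExp

/-- The value of a vector expression. -/
noncomputable def eval (e : VExp) (s : State) : Point := WithLp.toLp 2 fun i => (e i).eval s

/-- The vector in three consecutive variables. -/
def var (x : ℕ) : VExp := fun i => .var (x + i)

/-- The vector in entry `i` of the arrays `0`, `1`, `2`. -/
def point (i : IExp) : VExp := fun j => .get j i

/-- The vector `0`. -/
def zero : VExp := fun _ => .const 0

/-- The inner product of two vectors. -/
def dot (e f : VExp) : RExp :=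
  .add (.add (.mul (e 0) (f 0)) (.mul (e 1) (f 1))) (.mul (e 2) (f 2))

variable (s : State) (e f : VExp) (c : RExp)

@[simp] lemma eval_var (x : ℕ) : (var x).eval s = s.vec x := rfl

@[simp] lemma eval_point (i : IExp) : (point i).eval s = s.vector (i.eval s) := rfl

@[simp] lemma eval_zero : zero.eval s = 0 := by
  ext i
  simp [zero, eval]

@[simp] lemma eval_add : (e + f).eval s = e.eval s + f.eval s := rfl

@[simp] lemma eval_sub : (e - f).eval s = e.eval s - f.eval s := rfl

@[simp] lemma eval_smul : (c • e).eval s = c.eval s • e.eval s := rfl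

@[simp] lemma eval_dot : (dot e f).eval s = ⟪e.eval s, f.eval s⟫_ℝ := by
  simp [dot, eval, RExp.eval, PiLp.inner_apply, Fin.sum_univ_three, mul_comm]

/-- The coordinates of `e` can be assigned to the variables `x`, `x + 1`, `x + 2` one after the
other. -/
def Fresh (x : ℕ) : Prop := x ∉ (e 1).vars ∧ x ∉ (e 2).vars ∧ x + 1 ∉ (e 2).vars

instance (x : ℕ) : Decidable (e.Fresh x) := by unfold Fresh; infer_instance

end VExp

/-- Assignment of a vector to three consecutive variables. -/
def Program.setVec (x : ℕ) (e : VExp) : Program :=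
  .seq (.setReal x (e 0)) (.seq (.setReal (x + 1) (e 1)) (.setReal (x + 2) (e 2)))

lemma Program.run_setVec {x : ℕ} {e : VExp} (h : e.Fresh x) (s : State) :
    (Program.setVec x e).run s = s.setVec x (e.eval s) := by
  simp only [Program.setVec, Program.run, State.setVec]
  rw [RExp.eval_setReal h.2.2, RExp.eval_setReal h.2.1, RExp.eval_setReal h.1]
  rfl

lemma Program.loopFree_setVec (x : ℕ) (e : VExp) : (Program.setVec x e).LoopFree :=
  ⟨trivial, trivial, trivial⟩

end Vectors

/-! ### Two kinds of loops -/

section Loops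

/-- The loop that runs through the points of the input, with their number in the integer
variable `1`. -/
def Program.forPoints (body : Program) : Program :=
  .seq (.setInt 1 (.const 0))
    (.loop (.ilt (.var 1) (.var 0)) (.seq body (.setInt 1 (.add (.var 1) (.const 1)))))

lemma runs_forPoints {body : Program} {n T : ℕ} {Inv : ℕ → State → Prop}
    (hbody : ∀ k < n, ∀ s : State, s.intVar 0 = n → s.intVar 1 = k → Inv k s →
      Runs body s T fun s' => s'.intVar 0 = n ∧ s'.intVar 1 = k ∧ Inv (k + 1) (s'.setInt 1 (k + 1)))
    {s : State} (hn : s.intVar 0 = n) (h0 : Inv 0 (s.setInt 1 0)) :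
    Runs body.forPoints s (n * (T + 8) + 6) (Inv n) := by
  have hloop : ∀ m k, k + m = n → ∀ s : State, s.intVar 0 = n → s.intVar 1 = k → Inv k s →
      Runs (.loop (.ilt (.var 1) (.var 0)) (.seq body (.setInt 1 (.add (.var 1) (.const 1))))) s
        (m * (T + 8) + 4) (Inv n) := by
    intro m
    induction m with
    | zero =>
      intro k hk s hs0 hs1 hI
      refine ⟨_, s, .loopDone ?_, ?_, ?_⟩
      · simp only [Test.eval, IExp.eval]; omega
      · simp [Test.cost, IExp.cost]
      · rwa [← hk, add_zero]
    | succ m ih =>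
      intro k hk s hs0 hs1 hI
      obtain ⟨t, s', he, ht, hs0', hs1', hI'⟩ := hbody k (by omega) s hs0 hs1 hI
      have hval : IExp.eval s' (.add (.var 1) (.const 1)) = k + 1 := by simp [IExp.eval, hs1']
      obtain ⟨u, s'', he', hu, hI''⟩ := ih (k + 1) (by omega) (s'.setInt 1 (k + 1))
        (by simpa using hs0') (by simp) hI'
      refine ⟨_, s'', .loopStep ?_ (.seq he (.setInt s' 1 _)) (hval.symm ▸ he'), ?_, hI''⟩
      · simp only [Test.eval, IExp.eval]; omega
      · simp only [Test.cost, IExp.cost]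
        rw [add_mul]
        omega
  refine (Runs.seq (T := 2) (T' := n * (T + 8) + 4) (Q := (· = s.setInt 1 0))
    ⟨_, _, .setInt s 1 _, le_rfl, rfl⟩
    fun s' hs' => ?_).mono (by omega) fun _ h => h
  · subst hs'
    exact hloop n 0 (by omega) _ (by simpa using hn) (by simp) h0

/-- The loop in which the real variable `x` runs through the numbers `-L`, `-L + d`, `-L + 2 * d`
and so on up to `L`, where `d` is the value of the real variable `y`. -/
def Program.sweep (x y : ℕ) (L : ℚ) (body : Program) : Program :=
  .seq (.setReal x (.const (-L)))
    (.loop (.not (.rlt (.const L) (.var x))) (.seq body (.setReal x (.add (.var x) (.var y)))))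

/-- A sweep lowers the value of the real variable `q`: whatever the passes achieve one by one, the
whole sweep achieves, since `q` never increases. -/
lemma runs_sweep {body : Program} {x y q N T : ℕ} {L : ℚ} {d : ℝ} {I : State → Prop}
    {Low : ℝ → ℝ → Prop} (hLow : ∀ a c c', c' ≤ c → Low a c → Low a c') (hxq : q ≠ x)
    (hd : 0 < d) (hN : 2 * (L : ℝ) < N * d) (hI : ∀ s v, I s → I (s.setReal x v))
    (hIy : ∀ s, I s → s.realVar y = d)
    (hbody : ∀ s, I s → |s.realVar x| ≤ L → Runs body s T fun s' => I s' ∧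
      s'.realVar x = s.realVar x ∧ s'.realVar q ≤ s.realVar q ∧ Low (s.realVar x) (s'.realVar q))
    {s : State} (hs : I s) :
    Runs (.sweep x y L body) s (N * (T + 9) + 7) fun s' => I s' ∧ s'.realVar q ≤ s.realVar q ∧
      ∀ k : ℕ, -(L : ℝ) + k * d ≤ L → Low (-L + k * d) (s'.realVar q) := by
  have hloop : ∀ m j : ℕ, j + m = N → ∀ s : State, I s → s.realVar x = -L + j * d →
      Runs (.loop (.not (.rlt (.const L) (.var x)))
          (.seq body (.setReal x (.add (.var x) (.var y))))) s (m * (T + 9) + 5)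
        fun s' => I s' ∧ s'.realVar q ≤ s.realVar q ∧
          ∀ k : ℕ, j ≤ k → -(L : ℝ) + k * d ≤ L → Low (-L + k * d) (s'.realVar q) := by
    intro m
    induction m with
    | zero =>
      intro j hj s hs hx
      have hgt : (L : ℝ) < -L + j * d := by rw [← hj, add_zero] at hN; linarith
      refine ⟨_, s, .loopDone ?_, ?_, hs, le_rfl, fun k hk hle => ?_⟩
      · simp only [Test.eval, RExp.eval, hx, not_not]; exact hgt
      · simp [Test.cost, RExp.cost]
      · have : (j : ℝ) * d ≤ k * d := mul_le_mul_of_nonneg_right (by exact_mod_cast hk) hd.le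
        linarith
    | succ m ih =>
      intro j hj s hs hx
      by_cases hgt : (L : ℝ) < -L + j * d
      · refine ⟨_, s, .loopDone ?_, ?_, hs, le_rfl, fun k hk hle => ?_⟩
        · simp only [Test.eval, RExp.eval, hx, not_not]; exact hgt
        · simp [Test.cost, RExp.cost]
        · have : (j : ℝ) * d ≤ k * d := mul_le_mul_of_nonneg_right (by exact_mod_cast hk) hd.le
          linarith
      · have hj0 : 0 ≤ (j : ℝ) * d := by positivity
        obtain ⟨t, s', he, ht, hI', hx', hq', hlow⟩ := hbody s hs
          (by rw [hx, abs_le]; constructor <;> linarith)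
        have hval : RExp.eval s' (.add (.var x) (.var y)) = -L + (j + 1 : ℕ) * d := by
          simp only [RExp.eval, hx', hx, hIy s' hI']
          push_cast
          ring
        obtain ⟨u, s'', he', hu, hI'', hq'', hlow'⟩ := ih (j + 1) (by omega)
          (s'.setReal x (-L + (j + 1 : ℕ) * d)) (hI _ _ hI') (by simp)
        have hqx : (s'.setReal x (-L + (j + 1 : ℕ) * d)).realVar q = s'.realVar q := by simp [hxq]
        rw [hqx] at hq''
        refine ⟨_, s'', .loopStep ?_ (.seq he (.setReal s' x _)) (hval.symm ▸ he'), ?_, hI'',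
          hq''.trans hq', fun k hk hle => ?_⟩
        · simp only [Test.eval, RExp.eval, hx]; exact hgt
        · simp only [Test.cost, RExp.cost]
          rw [add_mul]
          omega
        · rcases hk.eq_or_lt with rfl | hlt
          · rw [hx] at hlow
            exact hLow _ _ _ hq'' hlow
          · exact hlow' k hlt hle
  refine (Runs.seq (T := 2) (T' := N * (T + 9) + 5) (Q := (· = s.setReal x (-L)))
    ⟨_, _, .setReal s x _, le_rfl, ?_⟩
    fun s' hs' => ?_).mono (by omega) fun _ h => h
  · simp [RExp.eval]
  · subst hs'
    refine (hloop N 0 (by omega) _ (hI _ _ hs) (by simp)).mono le_rfl fun s' h => ⟨h.1, ?_, ?_⟩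
    · simpa [hxq] using h.2.1
    · exact fun k => h.2.2 k (Nat.zero_le k)

end Loops

end RealRAM

namespace MinBox

open RealRAM
open scoped InnerProductSpace

/-! ### The program

Besides the input, the program uses the integer variable `1` as the counter of the loops through
the points, and the following real variables.

* `1`–`9`: the reference vectors, at `1`, `4` and `7`
* `10`–`12`, `13`–`15`: the longest residual so far, and the current residual
* `16`–`24`: the vectors of the current frame, at `16`, `19` and `22`
* `25`–`27`, `28`–`30`: the minimum and the maximum of the inner products of the points with the
  vectors of the current frame
* `31`: the current inner product
* `32`, `33`, `34`: the parameters `s`, `t`, `r` of the current frame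
* `35`: the step of the parameters
* `36`, `37`: the quotients `lam` and `mu` of the squared norms of the reference vectors
* `38`, `39`: the squared volume of the best box so far, and of the box of the current frame
* `40`–`51`: the best box so far, with corner at `40` and edges at `43`, `46` and `49`

Squared volumes are compared, since the machine has no square roots. -/

section Code

/-- The residual of a vector with respect to three vectors. -/
def residualExp (x a b c : VExp) : VExp :=
  x - (x.dot a / a.dot a) • a - (x.dot b / b.dot b) • b - (x.dot c / c.dot c) • c

/-- Finds a longest residual of the points, seen from the first point, with respect to the
vectors at `1`, `4` and `7`. -/
def farthest : Program :=
  .seq (.setVec 10 .zero) (.forPoints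
    (.seq
      (.setVec 13 (residualExp (.point (.var 1) - .point (.const 0)) (.var 1) (.var 4) (.var 7)))
      (.branch (.rlt (VExp.dot (.var 10) (.var 10)) (VExp.dot (.var 13) (.var 13)))
        (.setVec 10 (.var 13)) .skip)))

/-- Finds the minimum and the maximum of the inner products of the points with the vector at `d`. -/
def extent (d lo hi : ℕ) : Program :=
  .seq (.setReal lo (VExp.dot (.point (.const 0)) (.var d)))
    (.seq (.setReal hi (VExp.dot (.point (.const 0)) (.var d)))
      (.forPoints
        (.seq (.setReal 31 (VExp.dot (.point (.var 1)) (.var d)))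
          (.seq (.branch (.rlt (.var 31) (.var lo)) (.setReal lo (.var 31)) .skip)
            (.branch (.rlt (.var hi) (.var 31)) (.setReal hi (.var 31)) .skip)))))

/-- The vectors of the frame with the current parameters. -/
def frameExp : Fin 3 → VExp :=
  let s : RExp := .var 32
  let t : RExp := .var 33
  let r : RExp := .var 34
  let lam : RExp := .var 36
  let mu : RExp := .var 37
  let v (i : ℕ) : VExp := .var (1 + 3 * i)
  ![(.const 1 + t * t * mu + r * s * t * lam * mu) • v 0
      - (t * s * mu + r * s * s * lam * mu + r) • v 1 + (r * t - s) • v 2,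
    (r * lam) • v 0 + v 1 - (t + r * s * lam) • v 2,
    (s * lam * mu) • v 0 + (t * mu) • v 1 + v 2]

/-- The factor by which the vector at `16 + 3 * i` is multiplied to give an edge of the box. -/
def edgeFactor (i : ℕ) : RExp :=
  (.var (28 + i) - .var (25 + i)) / VExp.dot (.var (16 + 3 * i)) (.var (16 + 3 * i))

/-- The factor of the vector at `16 + 3 * i` in the corner of the box. -/
def cornerFactor (i : ℕ) : RExp :=
  .var (25 + i) / VExp.dot (.var (16 + 3 * i)) (.var (16 + 3 * i))

/-- The squared length of the edge parallel to the vector at `16 + 3 * i`. -/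
def edgeSq (i : ℕ) : RExp := (.var (28 + i) - .var (25 + i)) * edgeFactor i

/-- Computes the frame with the current parameters. -/
def setFrame : Program :=
  .seq (.setVec 16 (frameExp 0)) (.seq (.setVec 19 (frameExp 1)) (.setVec 22 (frameExp 2)))

/-- Replaces the best box by the box of the current frame. -/
def storeBox : Program :=
  .seq (.setReal 38 (.var 39))
    (.seq (.setVec 40 (cornerFactor 0 • VExp.var 16 + cornerFactor 1 • VExp.var 19
        + cornerFactor 2 • VExp.var 22))
      (.seq (.setVec 43 (edgeFactor 0 • VExp.var 16))
        (.seq (.setVec 46 (edgeFactor 1 • VExp.var 19))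
          (.setVec 49 (edgeFactor 2 • VExp.var 22)))))

/-- Replaces the best box by the box of the current frame if that is smaller. -/
def updateBox : Program :=
  .seq (.setReal 39 (edgeSq 0 * edgeSq 1 * edgeSq 2))
    (.branch (.rlt (.var 39) (.var 38)) storeBox .skip)

/-- Computes the box of the frame with the current parameters and compares it with the best one. -/
def tryFrame : Program :=
  .seq setFrame
    (.seq (extent 16 25 28) (.seq (extent 19 26 29) (.seq (extent 22 27 30) updateBox)))

/-- Tries all frames whose parameters lie in the grid. -/
def search : Program :=
  .sweep 32 35 7000 (.sweep 33 35 7000 (.sweep 34 35 7000 tryFrame))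

/-- Computes the reference vectors. -/
def setReference : Program :=
  .seq (.seq farthest (.setVec 1 (.var 10)))
    (.seq (.seq farthest (.setVec 4 (.var 10))) (.seq farthest (.setVec 7 (.var 10))))

/-- Stores the box that is centred at the first point and spanned by twice the reference vectors,
and prepares the search. -/
def setStart : Program :=
  .seq (.setReal 38 (.const 64 * VExp.dot (.var 1) (.var 1) * VExp.dot (.var 4) (.var 4)
      * VExp.dot (.var 7) (.var 7)))
    (.seq (.setVec 40 (.point (.const 0) - (VExp.var 1 + VExp.var 4 + VExp.var 7)))
      (.seq (.setVec 43 (RExp.const 2 • VExp.var 1))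
        (.seq (.setVec 46 (RExp.const 2 • VExp.var 4))
          (.seq (.setVec 49 (RExp.const 2 • VExp.var 7))
            (.seq (.setReal 35 (.var 0 / .const (2 * 10 ^ 14)))
              (.seq (.setReal 36 (VExp.dot (.var 4) (.var 4) / VExp.dot (.var 1) (.var 1)))
                (.setReal 37 (VExp.dot (.var 7) (.var 7) / VExp.dot (.var 4) (.var 4)))))))))

/-- Copies the vector at `x` to entry `k` of the arrays `0`, `1`, `2`. -/
def outputVec (k x : ℕ) : Program :=
  .seq (.putReal 0 (.const k) (.var x))
    (.seq (.putReal 1 (.const k) (.var (x + 1))) (.putReal 2 (.const k) (.var (x + 2))))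

/-- Copies the best box to the place of the output. -/
def outputBox : Program :=
  .seq (outputVec 0 40) (.seq (outputVec 1 43) (.seq (outputVec 2 46) (outputVec 3 49)))

/-- The program. The search is omitted if the first box has volume `0`. -/
def minBoxProgram : Program :=
  .seq setReference
    (.seq setStart (.seq (.branch (.rlt (.const 0) (.var 38)) search .skip) outputBox))

end Code

/-! ### Correctness of the program -/

section Correctness

variable {n : ℕ} {p : Fin n → Point}

/-- The state contains the points `p`. -/
structure HasPoints (p : Fin n → Point) (s : State) : Prop where
  count : s.intVar 0 = n
  vector : ∀ k : Fin n, s.vector k = p k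

lemma HasPoints.of_frame {s s' : State} {P : Program} (h : HasPoints p s) (hF : P.Frame s s')
    (hP : 0 ∉ P.intWrites ∧ P.arrWrites = []) : HasPoints p s' := by
  refine ⟨(hF.intVar 0 hP.1).trans h.count, fun k => (Eq.trans ?_ (h.vector k))⟩
  simp only [State.vector]
  congr 1
  funext j
  rw [hF.realArr j (by simp [hP.2])]

lemma HasPoints.setReal {s : State} (h : HasPoints p s) (x : ℕ) (v : ℝ) :
    HasPoints p (s.setReal x v) := ⟨h.count, h.vector⟩

lemma HasPoints.setVec {s : State} (h : HasPoints p s) (x : ℕ) (w : Point) :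
    HasPoints p (s.setVec x w) := ⟨h.count, h.vector⟩

lemma HasPoints.setInt {s : State} (h : HasPoints p s) {x : ℕ} (hx : 0 ≠ x) (k : ℕ) :
    HasPoints p (s.setInt x k) := ⟨by simpa [hx] using h.count, h.vector⟩

variable [NeZero n]

lemma HasPoints.vector_zero {s : State} (h : HasPoints p s) : s.vector 0 = p 0 := by
  rw [← h.vector 0, Fin.val_zero]

/-- As in the other statements of this form, the constant `K` depends on the program only, which
makes the running time linear in the number of points. -/
lemma runs_farthest : ∃ K : ℕ, ∀ (n : ℕ) [NeZero n] (p : Fin n → Point) (s : State),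
    HasPoints p s → Runs farthest s (K * n) fun s' => HasPoints p s' ∧ farthest.Frame s s' ∧
      (∃ k, s'.vec 10 = residual (s.vec 1) (s.vec 4) (s.vec 7) (p k - p 0)) ∧
      ∀ k, ‖residual (s.vec 1) (s.vec 4) (s.vec 7) (p k - p 0)‖ ≤ ‖s'.vec 10‖ := by
  set body : Program := .seq
      (.setVec 13 (residualExp (.point (.var 1) - .point (.const 0)) (.var 1) (.var 4) (.var 7)))
      (.branch (.rlt (VExp.dot (.var 10) (.var 10)) (VExp.dot (.var 13) (.var 13)))
        (.setVec 10 (.var 13)) .skip) with hbody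
  have hfree : body.LoopFree := ⟨Program.loopFree_setVec _ _, Program.loopFree_setVec _ _, trivial⟩
  refine ⟨(Program.setVec 10 .zero).time + (body.time + 8) + 6, fun n _ p s hp => ?_⟩
  have hn : 1 ≤ n := NeZero.one_le
  set R := fun k => residual (s.vec 1) (s.vec 4) (s.vec 7) (p k - p 0) with hR
  set Inv : ℕ → State → Prop := fun k s' => HasPoints p s' ∧ s'.vec 1 = s.vec 1 ∧
    s'.vec 4 = s.vec 4 ∧ s'.vec 7 = s.vec 7 ∧ (∃ j, s'.vec 10 = R j) ∧
    ∀ j : Fin n, (j : ℕ) < k → ‖R j‖ ≤ ‖s'.vec 10‖ with hInv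
  have hstep : ∀ k < n, ∀ s : State, s.intVar 0 = n → s.intVar 1 = k → Inv k s →
      Runs body s body.time fun s' => s'.intVar 0 = n ∧ s'.intVar 1 = k ∧
        Inv (k + 1) (s'.setInt 1 (k + 1)) := by
    rintro k hk s' h0 h1 ⟨hp', e1, e4, e7, ⟨j, hj⟩, hmax⟩
    refine hfree.runs_of ?_
    have hval : (residualExp (.point (.var 1) - .point (.const 0)) (.var 1) (.var 4)
        (.var 7)).eval s' = R ⟨k, hk⟩ := by
      have := hp'.vector ⟨k, hk⟩
      simp only at this
      simp [residualExp, IExp.eval, h1, this, hp'.vector_zero, e1, e4, e7, hR, residual]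
    have hrun : body.run s' = if ‖s'.vec 10‖ < ‖R ⟨k, hk⟩‖
        then (s'.setVec 13 (R ⟨k, hk⟩)).setVec 10 (R ⟨k, hk⟩)
        else s'.setVec 13 (R ⟨k, hk⟩) := by
      rw [hbody]
      simp only [Program.run]
      rw [Program.run_setVec (by decide), hval, Program.run_setVec (by decide)]
      simp only [Test.eval, VExp.eval_dot, VExp.eval_var, State.vec_setVec_self,
        State.vec_setVec (x := 13) (y := 10) _ _ (by decide), real_inner_self_eq_norm_sq]
      simp only [sq_lt_sq₀ (norm_nonneg _) (norm_nonneg _)]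
    rw [hrun]
    split_ifs with hlt
    · refine ⟨h0, h1, ((hp'.setVec _ _).setVec _ _).setInt (by decide) _, ?_, ?_, ?_, ?_, ?_⟩
      · simpa [State.vec_setVec] using e1
      · simpa [State.vec_setVec] using e4
      · simpa [State.vec_setVec] using e7
      · exact ⟨⟨k, hk⟩, by simp⟩
      · intro i hi
        simp only [State.vec_setInt, State.vec_setVec_self]
        rcases (Nat.lt_succ_iff.1 hi).lt_or_eq with hlt' | heq
        · exact (hmax i hlt').trans hlt.le
        · have : i = ⟨k, hk⟩ := Fin.ext heq
          rw [this]
    · refine ⟨h0, h1, (hp'.setVec _ _).setInt (by decide) _, ?_, ?_, ?_, ?_, ?_⟩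
      · simpa [State.vec_setVec] using e1
      · simpa [State.vec_setVec] using e4
      · simpa [State.vec_setVec] using e7
      · exact ⟨j, by simpa [State.vec_setVec] using hj⟩
      · intro i hi
        simp only [State.vec_setInt]
        rw [State.vec_setVec _ _ (by decide)]
        rcases (Nat.lt_succ_iff.1 hi).lt_or_eq with hlt' | heq
        · exact hmax i hlt'
        · have : i = ⟨k, hk⟩ := Fin.ext heq
          rw [this]
          exact not_lt.1 hlt
  have hrun : Runs farthest s ((Program.setVec 10 .zero).time + (n * (body.time + 8) + 6))
      (Inv n) := by
    refine ((Program.loopFree_setVec 10 .zero).runs s).seq fun s' hs' => ?_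
    rw [Program.run_setVec (by decide), VExp.eval_zero] at hs'
    subst hs'
    refine runs_forPoints hstep hp.count ⟨(hp.setVec _ _).setInt (by decide) _, ?_, ?_, ?_, ?_, ?_⟩
    · simp [State.vec_setVec]
    · simp [State.vec_setVec]
    · simp [State.vec_setVec]
    · exact ⟨0, by simp [hR, residual]⟩
    · exact fun j hj => absurd hj (Nat.not_lt_zero _)
  refine hrun.frame.mono ?_ ?_
  · nlinarith [Nat.zero_le ((Program.setVec 10 VExp.zero).time)]
  · rintro s' ⟨⟨hp', -, -, -, hj, hmax⟩, hF⟩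
    exact ⟨hp', hF, hj, fun k => hmax k k.2⟩

lemma runs_extent (d lo hi : ℕ) (h1 : d + 3 ≤ lo) (h2 : lo < hi) (h3 : hi < 31) :
    ∃ K : ℕ, ∀ (n : ℕ) [NeZero n] (p : Fin n → Point) (s : State),
    HasPoints p s → Runs (extent d lo hi) s (K * n) fun s' => HasPoints p s' ∧
      (extent d lo hi).Frame s s' ∧ s'.realVar lo = ⨅ k, ⟪p k, s.vec d⟫_ℝ ∧
      s'.realVar hi = ⨆ k, ⟪p k, s.vec d⟫_ℝ := by
  set body : Program := .seq (.setReal 31 (VExp.dot (.point (.var 1)) (.var d)))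
          (.seq (.branch (.rlt (.var 31) (.var lo)) (.setReal lo (.var 31)) .skip)
            (.branch (.rlt (.var hi) (.var 31)) (.setReal hi (.var 31)) .skip)) with hbody
  have hfree : body.LoopFree := ⟨trivial, ⟨trivial, trivial⟩, trivial, trivial⟩
  set start : ℕ → Program := fun x => .setReal x (VExp.dot (.point (.const 0)) (.var d))
  refine ⟨(start lo).time + (start hi).time + (body.time + 8) + 6, fun n _ p s hp => ?_⟩
  have hn : 1 ≤ n := NeZero.one_le
  have n1 : lo ≠ 31 := by omega
  have n2 : hi ≠ 31 := by omega
  have n3 : lo ≠ hi := by omega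
  set R := fun k => ⟪p k, s.vec d⟫_ℝ with hR
  set Inv : ℕ → State → Prop := fun k s' => HasPoints p s' ∧ s'.vec d = s.vec d ∧
    (∃ j, s'.realVar lo = R j) ∧ (∃ j, s'.realVar hi = R j) ∧
    ∀ j : Fin n, (j : ℕ) < k → s'.realVar lo ≤ R j ∧ R j ≤ s'.realVar hi with hInv
  have hstep : ∀ k < n, ∀ s : State, s.intVar 0 = n → s.intVar 1 = k → Inv k s →
      Runs body s body.time fun s' => s'.intVar 0 = n ∧ s'.intVar 1 = k ∧
        Inv (k + 1) (s'.setInt 1 (k + 1)) := by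
    rintro k hk s' h0 h1' ⟨hp', ed, ⟨j, hj⟩, ⟨j', hj'⟩, hmax⟩
    have hval : (VExp.dot (.point (.var 1)) (.var d)).eval s' = R ⟨k, hk⟩ := by
      have := hp'.vector ⟨k, hk⟩
      simp only at this
      simp [IExp.eval, h1', this, ed, hR]
    have hlo : (body.run s').realVar lo = min (s'.realVar lo) (R ⟨k, hk⟩) := by
      by_cases ha : R ⟨k, hk⟩ < s'.realVar lo <;> by_cases hb : s'.realVar hi < R ⟨k, hk⟩ <;>
        simp [hbody, Program.run, Test.eval, hval, n1, n2, n3, n3.symm, ha, hb] <;>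
        first | exact ha.le | exact not_lt.1 ha
    have hhi : (body.run s').realVar hi = max (s'.realVar hi) (R ⟨k, hk⟩) := by
      by_cases ha : R ⟨k, hk⟩ < s'.realVar lo <;> by_cases hb : s'.realVar hi < R ⟨k, hk⟩ <;>
        simp [hbody, Program.run, Test.eval, hval, n1, n2, n3.symm, ha, hb] <;>
        first | exact hb.le | exact not_lt.1 hb
    refine (hfree.runs s').frame.mono le_rfl ?_
    rintro s'' ⟨rfl, hF⟩
    have hi0 : ∀ x, x ∉ body.intWrites := by simp [hbody, Program.intWrites]
    have hp'' := hp'.of_frame hF ⟨hi0 0, rfl⟩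
    refine ⟨hp''.count, (hF.intVar 1 (hi0 1)).trans h1', hp''.setInt (by decide) _, ?_, ?_, ?_,
      fun i hi' => ?_⟩
    · rw [State.vec_setInt, ← ed]
      refine hF.vec ?_
      simp [hbody, Program.realWrites]
      omega
    · rw [State.realVar_setInt, hlo]
      rcases min_choice (s'.realVar lo) (R ⟨k, hk⟩) with h | h
      · exact ⟨j, h.trans hj⟩
      · exact ⟨_, h⟩
    · rw [State.realVar_setInt, hhi]
      rcases max_choice (s'.realVar hi) (R ⟨k, hk⟩) with h | h
      · exact ⟨j', h.trans hj'⟩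
      · exact ⟨_, h⟩
    · rw [State.realVar_setInt, hlo, hhi]
      rcases (Nat.lt_succ_iff.1 hi').lt_or_eq with h | h
      · exact ⟨(min_le_left _ _).trans (hmax i h).1, (hmax i h).2.trans (le_max_left _ _)⟩
      · have : i = ⟨k, hk⟩ := Fin.ext h
        rw [this]
        exact ⟨min_le_right _ _, le_max_right _ _⟩
  have hrun : Runs (extent d lo hi) s ((start lo).time + ((start hi).time
      + (n * (body.time + 8) + 6))) (Inv n) := by
    refine (Program.LoopFree.runs (P := start lo) trivial s).seq fun s' hs' =>
      (Program.LoopFree.runs (P := start hi) trivial s').seq fun s'' hs'' => ?_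
    have e1 : (start lo).run s = s.setReal lo (R 0) := by
      simp [start, Program.run, IExp.eval, hp.vector_zero, hR]
    rw [e1] at hs'
    have e2 : (start hi).run s' = s'.setReal hi (R 0) := by
      rw [hs']
      simp [start, Program.run, IExp.eval, hp.vector_zero, hR, State.vec_setReal _ _ (Or.inr h1)]
    rw [e2, hs'] at hs''
    subst hs''
    refine runs_forPoints hstep hp.count
      ⟨((hp.setReal _ _).setReal _ _).setInt (by decide) _, ?_, ⟨0, ?_⟩, ⟨0, ?_⟩, ?_⟩
    · rw [State.vec_setInt, State.vec_setReal _ _ (by omega), State.vec_setReal _ _ (by omega)]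
    · simp [n3]
    · simp
    · exact fun j hj => absurd hj (Nat.not_lt_zero _)
  refine hrun.frame.mono ?_ ?_
  · nlinarith [Nat.zero_le ((start lo).time), Nat.zero_le ((start hi).time)]
  · rintro s' ⟨⟨hp', -, ⟨j, hj⟩, ⟨j', hj'⟩, hmax⟩, hF⟩
    refine ⟨hp', hF, ?_, ?_⟩
    · refine le_antisymm (le_ciInf fun k => (hmax k k.2).1) ?_
      rw [hj]
      exact iInf_inner_le p _ j
    · refine le_antisymm ?_ (ciSup_le fun k => (hmax k k.2).2)
      rw [hj']
      exact inner_le_iSup p _ j'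

end Correctness

/-! ### Correctness of the search -/

section Search

variable {n : ℕ} {p : Fin n → Point} {v : Fin 3 → Point} {lam mu d : ℝ}

/-- The best box so far is a bounding box of the points, and its squared volume is the value of the
variable `38`. -/
def StoresBox (p : Fin n → Point) (s : State) : Prop :=
  ∃ B : Box, B.Bounds (Set.range p) ∧ s.realVar 38 = B.vol ^ 2 ∧ s.vec 40 = B.corner ∧
    s.vec 43 = B.edge 0 ∧ s.vec 46 = B.edge 1 ∧ s.vec 49 = B.edge 2

/-- The invariant of the search. -/
structure SearchInv (p : Fin n → Point) (v : Fin 3 → Point) (lam mu d : ℝ) (s : State) : Prop where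
  points : HasPoints p s
  vec_one : s.vec 1 = v 0
  vec_four : s.vec 4 = v 1
  vec_seven : s.vec 7 = v 2
  step : s.realVar 35 = d
  lam : s.realVar 36 = lam
  mu : s.realVar 37 = mu
  box : StoresBox p s

lemma SearchInv.setReal {s : State} (h : SearchInv p v lam mu d s) {x : ℕ}
    (hx : x = 32 ∨ x = 33 ∨ x = 34) (a : ℝ) : SearchInv p v lam mu d (s.setReal x a) := by
  obtain ⟨B, h1, h2, h3, h4, h5, h6⟩ := h.box
  have hvec : ∀ y, y + 3 ≤ 32 ∨ 34 < y → (s.setReal x a).vec y = s.vec y := fun y hy =>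
    State.vec_setReal _ _ (by omega)
  have hvar : ∀ y, y < 32 ∨ 34 < y → (s.setReal x a).realVar y = s.realVar y := fun y hy => by
    have : y ≠ x := by omega
    simp [this]
  exact ⟨h.points.setReal x a, (hvec 1 (by decide)).trans h.vec_one,
    (hvec 4 (by decide)).trans h.vec_four, (hvec 7 (by decide)).trans h.vec_seven,
    (hvar 35 (by decide)).trans h.step, (hvar 36 (by decide)).trans h.lam,
    (hvar 37 (by decide)).trans h.mu, B, h1, (hvar 38 (by decide)).trans h2,
    (hvec 40 (by decide)).trans h3, (hvec 43 (by decide)).trans h4,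
    (hvec 46 (by decide)).trans h5, (hvec 49 (by decide)).trans h6⟩

lemma eval_frameExp {s : State} (h1 : s.vec 1 = v 0) (h4 : s.vec 4 = v 1) (h7 : s.vec 7 = v 2)
    (i : Fin 3) : (frameExp i).eval s
      = frame v (s.realVar 36) (s.realVar 37) (s.realVar 32) (s.realVar 33) (s.realVar 34) i := by
  fin_cases i <;> simp [frameExp, frame, h1, h4, h7] <;> module

/-- The squared volume of the box of the frame with parameters `a`, `b`, `c`. -/
noncomputable def frameVolSq (p : Fin n → Point) (v : Fin 3 → Point) (lam mu a b c : ℝ) : ℝ :=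
  (∏ i, width p (frame v lam mu a b c i) / ‖frame v lam mu a b c i‖) ^ 2

lemma run_setFrame (s : State) (h1 : s.vec 1 = v 0) (h4 : s.vec 4 = v 1) (h7 : s.vec 7 = v 2) :
    ∀ i : Fin 3, (setFrame.run s).vec (16 + 3 * i)
      = frame v (s.realVar 36) (s.realVar 37) (s.realVar 32) (s.realVar 33) (s.realVar 34) i := by
  have e : setFrame.run s = ((s.setVec 16 ((frameExp 0).eval s)).setVec 19
      ((frameExp 1).eval (s.setVec 16 ((frameExp 0).eval s)))).setVec 22
      ((frameExp 2).eval ((s.setVec 16 ((frameExp 0).eval s)).setVec 19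
      ((frameExp 1).eval (s.setVec 16 ((frameExp 0).eval s))))) := by
    simp only [setFrame, Program.run]
    rw [Program.run_setVec (by decide), Program.run_setVec (by decide),
      Program.run_setVec (by decide)]
  have hw : ∀ w : Point, (frameExp 1).eval (s.setVec 16 w) = (frameExp 1).eval s := fun w => by
    rw [eval_frameExp h1 h4 h7, eval_frameExp (v := v)]
    all_goals simp [State.vec_setVec, State.realVar_setVec, h1, h4, h7]
  have hw' : ∀ w w' : Point, (frameExp 2).eval ((s.setVec 16 w).setVec 19 w')
      = (frameExp 2).eval s := fun w w' => by
    rw [eval_frameExp h1 h4 h7, eval_frameExp (v := v)]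
    all_goals simp [State.vec_setVec, State.realVar_setVec, h1, h4, h7]
  intro i
  rw [e, hw, hw', ← eval_frameExp h1 h4 h7]
  fin_cases i <;> simp [State.vec_setVec]

/-- The program `updateBox`, run when a frame `D` and its extents have been computed. -/
lemma run_updateBox [NeZero n] {D : Fin 3 → Point} (hD : ∀ i j, i ≠ j → ⟪D i, D j⟫_ℝ = 0)
    (h0 : ∀ i, D i ≠ 0) {s : State} (hs : SearchInv p v lam mu d s)
    (hvec : ∀ i : Fin 3, s.vec (16 + 3 * i) = D i)
    (hlo : ∀ i : Fin 3, s.realVar (25 + i) = ⨅ k, ⟪p k, D i⟫_ℝ)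
    (hhi : ∀ i : Fin 3, s.realVar (28 + i) = ⨆ k, ⟪p k, D i⟫_ℝ) :
    SearchInv p v lam mu d (updateBox.run s) ∧
      (updateBox.run s).realVar 38 ≤ s.realVar 38 ∧
      (updateBox.run s).realVar 38 ≤ (∏ i, width p (D i) / ‖D i‖) ^ 2 := by
  have v0 : s.vec 16 = D 0 := hvec 0
  have v1 : s.vec 19 = D 1 := hvec 1
  have v2 : s.vec 22 = D 2 := hvec 2
  have l0 : s.realVar 25 = ⨅ k, ⟪p k, D 0⟫_ℝ := hlo 0
  have l1 : s.realVar 26 = ⨅ k, ⟪p k, D 1⟫_ℝ := hlo 1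
  have l2 : s.realVar 27 = ⨅ k, ⟪p k, D 2⟫_ℝ := hlo 2
  have u0 : s.realVar 28 = ⨆ k, ⟪p k, D 0⟫_ℝ := hhi 0
  have u1 : s.realVar 29 = ⨆ k, ⟪p k, D 1⟫_ℝ := hhi 1
  have u2 : s.realVar 30 = ⨆ k, ⟪p k, D 2⟫_ℝ := hhi 2
  set q := (∏ i, width p (D i) / ‖D i‖) ^ 2 with hq
  have hcand : RExp.eval s (edgeSq 0 * edgeSq 1 * edgeSq 2) = q := by
    have hne := fun i => norm_ne_zero_iff.2 (h0 i)
    have n0 := hne 0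
    have n1 := hne 1
    have n2 := hne 2
    simp only [edgeSq, edgeFactor, RExp.eval_mul, RExp.eval_sub, RExp.eval_div, RExp.eval_var,
      VExp.eval_dot, VExp.eval_var, hq, Fin.prod_univ_three, width, Nat.reduceMul, Nat.reduceAdd,
      v0, v1, v2, l0, l1, l2, u0, u1, u2, real_inner_self_eq_norm_sq]
    field_simp
  obtain ⟨B, b1, b2, b3, b4, b5, b6⟩ := hs.box
  by_cases hlt : q < s.realVar 38
  · have hrun : updateBox.run s = (((((s.setReal 39 q).setReal 38 q).setVec 40
        (frameBox p D hD).corner).setVec 43 ((frameBox p D hD).edge 0)).setVec 46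
        ((frameBox p D hD).edge 1)).setVec 49 ((frameBox p D hD).edge 2) := by
      have : (Test.rlt (.var 39) (.var 38)).eval (s.setReal 39 q) := by simpa [Test.eval] using hlt
      have e : (Program.setReal 39 (edgeSq 0 * edgeSq 1 * edgeSq 2)).run s = s.setReal 39 q :=
        congrArg _ hcand
      rw [updateBox, Program.run, e, Program.run_branch_of_true this]
      simp only [storeBox, Program.run]
      rw [Program.run_setVec (by decide), Program.run_setVec (by decide),
        Program.run_setVec (by decide), Program.run_setVec (by decide)]
      simp [cornerFactor, edgeFactor, State.vec_setVec, State.realVar_setVec, State.vec_setReal,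
        v0, v1, v2, l0, l1, l2, u0, u1, u2, frameBox, width, Fin.sum_univ_three]
    rw [hrun]
    refine ⟨⟨(((((hs.points.setReal _ _).setReal _ _).setVec _ _).setVec _ _).setVec _ _).setVec
      _ _, ?_, ?_, ?_, ?_, ?_, ?_, frameBox p D hD, frameBox_bounds p hD h0, ?_, ?_, ?_, ?_, ?_⟩,
      ?_, ?_⟩
    · simpa [State.vec_setVec, State.vec_setReal] using hs.vec_one
    · simpa [State.vec_setVec, State.vec_setReal] using hs.vec_four
    · simpa [State.vec_setVec, State.vec_setReal] using hs.vec_seven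
    · simpa [State.realVar_setVec] using hs.step
    · simpa [State.realVar_setVec] using hs.lam
    · simpa [State.realVar_setVec] using hs.mu
    · simp [State.realVar_setVec, hq, vol_frameBox p hD h0]
    · simp [State.vec_setVec]
    · simp [State.vec_setVec]
    · simp [State.vec_setVec]
    · simp
    · simpa [State.realVar_setVec] using hlt.le
    · simp [State.realVar_setVec]
  · have hrun : updateBox.run s = s.setReal 39 q := by
      have : ¬(Test.rlt (.var 39) (.var 38)).eval (s.setReal 39 q) := by
        simpa [Test.eval] using hlt
      have e : (Program.setReal 39 (edgeSq 0 * edgeSq 1 * edgeSq 2)).run s = s.setReal 39 q :=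
        congrArg _ hcand
      rw [updateBox, Program.run, e, Program.run_branch_of_false this]
      rfl
    rw [hrun]
    refine ⟨⟨hs.points.setReal _ _, ?_, ?_, ?_, ?_, ?_, ?_, B, b1, ?_, ?_, ?_, ?_, ?_⟩, ?_, ?_⟩
    · simpa [State.vec_setReal] using hs.vec_one
    · simpa [State.vec_setReal] using hs.vec_four
    · simpa [State.vec_setReal] using hs.vec_seven
    · simpa using hs.step
    · simpa using hs.lam
    · simpa using hs.mu
    · simpa using b2
    · simpa [State.vec_setReal] using b3
    · simpa [State.vec_setReal] using b4
    · simpa [State.vec_setReal] using b5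
    · simpa [State.vec_setReal] using b6
    · simp
    · simpa using not_lt.1 hlt

lemma SearchInv.of_frame {s s' : State} {P : Program} (h : SearchInv p v lam mu d s)
    (hF : P.Frame s s') (hP : 0 ∉ P.intWrites ∧ P.arrWrites = [])
    (hw : ∀ x ∈ P.realWrites, 16 ≤ x ∧ x < 35) : SearchInv p v lam mu d s' := by
  obtain ⟨B, h1, h2, h3, h4, h5, h6⟩ := h.box
  have hvar : ∀ y, y < 16 ∨ 35 ≤ y → s'.realVar y = s.realVar y := fun y hy =>
    hF.realVar y fun hmem => by have := hw y hmem; omega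
  have hvec : ∀ y, y + 3 ≤ 16 ∨ 35 ≤ y → s'.vec y = s.vec y := fun y hy =>
    hF.vec ⟨fun hmem => by have := hw _ hmem; omega, fun hmem => by have := hw _ hmem; omega,
      fun hmem => by have := hw _ hmem; omega⟩
  exact ⟨h.points.of_frame hF hP, (hvec 1 (by decide)).trans h.vec_one,
    (hvec 4 (by decide)).trans h.vec_four, (hvec 7 (by decide)).trans h.vec_seven,
    (hvar 35 (by decide)).trans h.step, (hvar 36 (by decide)).trans h.lam,
    (hvar 37 (by decide)).trans h.mu, B, h1, (hvar 38 (by decide)).trans h2,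
    (hvec 40 (by decide)).trans h3, (hvec 43 (by decide)).trans h4,
    (hvec 46 (by decide)).trans h5, (hvec 49 (by decide)).trans h6⟩

/-- One pass of the search: whether or not the box is replaced, the value of `38` is afterwards at
most the squared volume of the box of the current frame. -/
lemma runs_tryFrame : ∃ K : ℕ, ∀ (n : ℕ) [NeZero n] (p : Fin n → Point) (v : Fin 3 → Point)
    (lam mu d : ℝ), (∀ i j, i ≠ j → ⟪v i, v j⟫_ℝ = 0) → (∀ i, v i ≠ 0) →
    ‖v 1‖ ^ 2 = lam * ‖v 0‖ ^ 2 → ‖v 2‖ ^ 2 = mu * ‖v 1‖ ^ 2 → 0 ≤ lam → 0 ≤ mu →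
    ∀ s : State, SearchInv p v lam mu d s →
    Runs tryFrame s (K * n) fun s' => SearchInv p v lam mu d s' ∧ tryFrame.Frame s s' ∧
      s'.realVar 38 ≤ s.realVar 38 ∧ s'.realVar 38
        ≤ frameVolSq p v lam mu (s.realVar 32) (s.realVar 33) (s.realVar 34) := by
  obtain ⟨K0, hK0⟩ := runs_extent 16 25 28 (by decide) (by decide) (by decide)
  obtain ⟨K1, hK1⟩ := runs_extent 19 26 29 (by decide) (by decide) (by decide)
  obtain ⟨K2, hK2⟩ := runs_extent 22 27 30 (by decide) (by decide) (by decide)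
  refine ⟨setFrame.time + K0 + K1 + K2 + updateBox.time,
    fun n _ p v lam mu d hv h0 hB hC hlam hmu s hs => ?_⟩
  have hn : 1 ≤ n := NeZero.one_le
  set D := frame v lam mu (s.realVar 32) (s.realVar 33) (s.realVar 34) with hD
  have free0 : setFrame.LoopFree := ⟨Program.loopFree_setVec _ _, Program.loopFree_setVec _ _,
    Program.loopFree_setVec _ _⟩
  have free1 : updateBox.LoopFree := ⟨trivial, ⟨trivial, Program.loopFree_setVec _ _,
    Program.loopFree_setVec _ _, Program.loopFree_setVec _ _, Program.loopFree_setVec _ _⟩, trivial⟩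
  have hrun : Runs tryFrame s (setFrame.time + (K0 * n + (K1 * n + (K2 * n + updateBox.time))))
      fun s' => SearchInv p v lam mu d s' ∧ s'.realVar 38 ≤ s.realVar 38 ∧
        s'.realVar 38 ≤ frameVolSq p v lam mu (s.realVar 32) (s.realVar 33) (s.realVar 34) := by
    refine (free0.runs s).frame.seq fun s1 ⟨hs1, F1⟩ => ?_
    have hvec := run_setFrame s hs.vec_one hs.vec_four hs.vec_seven
    rw [← hs1, hs.lam, hs.mu] at hvec
    have i1 := hs.of_frame F1 (by decide) (by decide)
    have q1 : s1.realVar 38 = s.realVar 38 := F1.realVar 38 (by decide)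
    refine (hK0 n p s1 i1.points).seq fun s2 ⟨hp2, F2, lo2, hi2⟩ => ?_
    have i2 := i1.of_frame F2 (by decide) (by decide)
    refine (hK1 n p s2 i2.points).seq fun s3 ⟨hp3, F3, lo3, hi3⟩ => ?_
    have i3 := i2.of_frame F3 (by decide) (by decide)
    refine (hK2 n p s3 i3.points).seq fun s4 ⟨hp4, F4, lo4, hi4⟩ => ?_
    have i4 := i3.of_frame F4 (by decide) (by decide)
    have w0 : s1.vec 16 = D 0 := hvec 0
    have w1 : s1.vec 19 = D 1 := hvec 1
    have w2 : s1.vec 22 = D 2 := hvec 2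
    rw [w0] at lo2 hi2
    rw [F2.vec (by decide), w1] at lo3 hi3
    rw [F3.vec (by decide), F2.vec (by decide), w2] at lo4 hi4
    refine free1.runs_of ?_
    have hup := run_updateBox (D := D) (frame_orthogonal hv hB hC _ _ _)
      (frame_ne_zero hv hB hC hlam hmu h0 _ _ _) (s := s4) i4 (p := p) (fun i => ?_) (fun i => ?_)
      (fun i => ?_)
    · refine ⟨hup.1, hup.2.1.trans (le_of_eq ?_), hup.2.2⟩
      rw [F4.realVar 38 (by decide), F3.realVar 38 (by decide), F2.realVar 38 (by decide), q1]
    · fin_cases i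
      · exact (F4.vec (by decide)).trans
          ((F3.vec (by decide)).trans ((F2.vec (by decide)).trans w0))
      · exact (F4.vec (by decide)).trans
          ((F3.vec (by decide)).trans ((F2.vec (by decide)).trans w1))
      · exact (F4.vec (by decide)).trans
          ((F3.vec (by decide)).trans ((F2.vec (by decide)).trans w2))
    · fin_cases i
      · exact (F4.realVar 25 (by decide)).trans ((F3.realVar 25 (by decide)).trans lo2)
      · exact (F4.realVar 26 (by decide)).trans lo3
      · exact lo4
    · fin_cases i
      · exact (F4.realVar 28 (by decide)).trans ((F3.realVar 28 (by decide)).trans hi2)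
      · exact (F4.realVar 29 (by decide)).trans hi3
      · exact hi4
  refine hrun.frame.mono ?_ fun s' ⟨h, hF⟩ => ⟨h.1, hF, h.2⟩
  nlinarith [Nat.zero_le setFrame.time, Nat.zero_le updateBox.time]

lemma runs_search : ∃ K : ℕ, ∀ (n : ℕ) [NeZero n] (p : Fin n → Point) (v : Fin 3 → Point)
    (lam mu d : ℝ), (∀ i j, i ≠ j → ⟪v i, v j⟫_ℝ = 0) → (∀ i, v i ≠ 0) →
    ‖v 1‖ ^ 2 = lam * ‖v 0‖ ^ 2 → ‖v 2‖ ^ 2 = mu * ‖v 1‖ ^ 2 → 0 ≤ lam → 0 ≤ mu → 0 < d →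
    ∀ N : ℕ, 1 ≤ N → 2 * 7000 < N * d → ∀ s : State, SearchInv p v lam mu d s →
    Runs search s (K * (n * N ^ 3)) fun s' => SearchInv p v lam mu d s' ∧
      ∀ i j k : ℕ, -7000 + i * d ≤ 7000 → -7000 + j * d ≤ 7000 → -7000 + k * d ≤ 7000 →
        s'.realVar 38
          ≤ frameVolSq p v lam mu (-7000 + i * d) (-7000 + j * d) (-7000 + k * d) := by
  obtain ⟨K, hK⟩ := runs_tryFrame
  refine ⟨K + 48, fun n _ p v lam mu d hv h0 hB hC hlam hmu hd N hN1 hN s hs => ?_⟩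
  have hn : 1 ≤ n := NeZero.one_le
  have hL : ((7000 : ℚ) : ℝ) = 7000 := by norm_num
  have hN' : 2 * ((7000 : ℚ) : ℝ) < N * d := by rwa [hL]
  set F := frameVolSq p v lam mu with hF
  have inner : ∀ a b : ℝ, ∀ s : State,
      (SearchInv p v lam mu d s ∧ s.realVar 32 = a ∧ s.realVar 33 = b) →
      Runs (.sweep 34 35 7000 tryFrame) s (N * (K * n + 9) + 7) fun s' =>
        (SearchInv p v lam mu d s' ∧ s'.realVar 32 = a ∧ s'.realVar 33 = b) ∧
        s'.realVar 38 ≤ s.realVar 38 ∧ ∀ k : ℕ, -((7000 : ℚ) : ℝ) + k * d ≤ (7000 : ℚ) →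
          s'.realVar 38 ≤ F a b (-((7000 : ℚ) : ℝ) + k * d) := by
    intro a b s hs
    refine runs_sweep (Low := fun c q => q ≤ F a b c) (fun _ _ _ => le_trans) (by decide) hd hN'
      (I := fun s => SearchInv p v lam mu d s ∧ s.realVar 32 = a ∧ s.realVar 33 = b)
      (fun s c h => ⟨h.1.setReal (by decide) c, by simpa using h.2.1, by simpa using h.2.2⟩)
      (fun s h => h.1.step) (fun s h _ => ?_) hs
    refine (hK n p v lam mu d hv h0 hB hC hlam hmu s h.1).mono le_rfl
      fun s' ⟨i', hFr, hle, hlow⟩ => ⟨⟨i', ?_, ?_⟩, ?_, hle, ?_⟩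
    · rw [hFr.realVar 32 (by decide), h.2.1]
    · rw [hFr.realVar 33 (by decide), h.2.2]
    · exact hFr.realVar 34 (by decide)
    · rwa [h.2.1, h.2.2] at hlow
  have middle : ∀ a : ℝ, ∀ s : State, (SearchInv p v lam mu d s ∧ s.realVar 32 = a) →
      Runs (.sweep 33 35 7000 (.sweep 34 35 7000 tryFrame)) s
        (N * (N * (K * n + 9) + 7 + 9) + 7) fun s' =>
        (SearchInv p v lam mu d s' ∧ s'.realVar 32 = a) ∧
        s'.realVar 38 ≤ s.realVar 38 ∧ ∀ j : ℕ, -((7000 : ℚ) : ℝ) + j * d ≤ (7000 : ℚ) →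
          ∀ k : ℕ, -((7000 : ℚ) : ℝ) + k * d ≤ (7000 : ℚ) →
          s'.realVar 38 ≤ F a (-((7000 : ℚ) : ℝ) + j * d) (-((7000 : ℚ) : ℝ) + k * d) := by
    intro a s hs
    refine runs_sweep (Low := fun b q => ∀ k : ℕ, -((7000 : ℚ) : ℝ) + k * d ≤ (7000 : ℚ) →
        q ≤ F a b (-((7000 : ℚ) : ℝ) + k * d)) (fun _ _ _ hle h k hk => hle.trans (h k hk))
      (by decide) hd hN' (I := fun s => SearchInv p v lam mu d s ∧ s.realVar 32 = a)
      (fun s c h => ⟨h.1.setReal (by decide) c, by simpa using h.2⟩)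
      (fun s h => h.1.step) (fun s h _ => ?_) hs
    exact (inner a (s.realVar 33) s ⟨h.1, h.2, rfl⟩).mono le_rfl
      fun s' ⟨⟨i', ha, hb⟩, hle, hlow⟩ => ⟨⟨i', ha⟩, hb, hle, hlow⟩
  have outer : Runs search s (N * (N * (N * (K * n + 9) + 7 + 9) + 7 + 9) + 7) fun s' =>
        SearchInv p v lam mu d s' ∧
        s'.realVar 38 ≤ s.realVar 38 ∧ ∀ i : ℕ, -((7000 : ℚ) : ℝ) + i * d ≤ (7000 : ℚ) →
          ∀ j : ℕ, -((7000 : ℚ) : ℝ) + j * d ≤ (7000 : ℚ) →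
          ∀ k : ℕ, -((7000 : ℚ) : ℝ) + k * d ≤ (7000 : ℚ) →
          s'.realVar 38 ≤ F (-((7000 : ℚ) : ℝ) + i * d) (-((7000 : ℚ) : ℝ) + j * d)
            (-((7000 : ℚ) : ℝ) + k * d) := by
    refine runs_sweep (Low := fun a q => ∀ j : ℕ, -((7000 : ℚ) : ℝ) + j * d ≤ (7000 : ℚ) →
        ∀ k : ℕ, -((7000 : ℚ) : ℝ) + k * d ≤ (7000 : ℚ) →
        q ≤ F a (-((7000 : ℚ) : ℝ) + j * d) (-((7000 : ℚ) : ℝ) + k * d))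
      (fun _ _ _ hle h j hj k hk => hle.trans (h j hj k hk)) (by decide) hd hN'
      (fun s c h => h.setReal (by decide) c) (fun s h => h.step) (fun s h _ => ?_) hs
    exact (middle (s.realVar 32) s ⟨h, rfl⟩).mono le_rfl
      fun s' ⟨⟨i', ha⟩, hle, hlow⟩ => ⟨i', ha, hle, hlow⟩
  refine outer.mono ?_ fun s' ⟨i', _, hlow⟩ => ⟨i', fun i j k hi hj hk => ?_⟩
  · have hN0 : 1 ≤ n * N ^ 3 := Nat.mul_pos hn (pow_pos hN1 3)
    have hN2 : N ≤ n * N ^ 3 := by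
      calc N = 1 * (N * 1) := by ring
        _ ≤ n * (N * N ^ 2) := Nat.mul_le_mul hn (Nat.mul_le_mul_left _ (Nat.one_le_pow 2 N hN1))
        _ = n * N ^ 3 := by ring
    have hN3 : N ^ 2 ≤ n * N ^ 3 := by
      calc N ^ 2 = 1 * (N ^ 2 * 1) := by ring
        _ ≤ n * (N ^ 2 * N) := Nat.mul_le_mul hn (Nat.mul_le_mul_left _ hN1)
        _ = n * N ^ 3 := by ring
    have hN4 : N ^ 3 ≤ n * N ^ 3 := Nat.le_mul_of_pos_left _ hn
    calc N * (N * (N * (K * n + 9) + 7 + 9) + 7 + 9) + 7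
        = K * (n * N ^ 3) + 9 * N ^ 3 + 16 * N ^ 2 + 16 * N + 7 := by ring
      _ ≤ K * (n * N ^ 3) + 9 * (n * N ^ 3) + 16 * (n * N ^ 3) + 16 * (n * N ^ 3)
          + 7 * (n * N ^ 3) := by omega
      _ = (K + 48) * (n * N ^ 3) := by ring
  · rw [hL] at hlow
    exact hlow i hi j hj k hk

end Search

/-! ### Correctness of the whole program -/

lemma exists_grid_point {L d x : ℝ} (hd : 0 < d) (hx : |x| ≤ L) :
    ∃ k : ℕ, -L + k * d ≤ L ∧ |-L + k * d| ≤ L ∧ |-L + k * d - x| ≤ d := by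
  rw [abs_le] at hx
  have h0 : 0 ≤ (x + L) / d := div_nonneg (by linarith) hd.le
  have h1 := (le_div_iff₀ hd).1 (Nat.floor_le h0)
  have h2 := (div_lt_iff₀ hd).1 (Nat.lt_floor_add_one ((x + L) / d))
  have h3 : 0 ≤ (⌊(x + L) / d⌋₊ : ℝ) * d := by positivity
  refine ⟨⌊(x + L) / d⌋₊, by linarith, abs_le.2 ⟨by linarith, by linarith⟩,
    abs_le.2 ⟨by linarith, by linarith⟩⟩

lemma runs_farthest_setVec {x : ℕ} (hx : x + 3 ≤ 10) : ∃ K : ℕ, ∀ (n : ℕ) [NeZero n]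
    (p : Fin n → Point) (s : State), HasPoints p s →
    Runs (.seq farthest (.setVec x (.var 10))) s (K * n) fun s' => HasPoints p s' ∧
      (∃ k, s'.vec x = residual (s.vec 1) (s.vec 4) (s.vec 7) (p k - p 0)) ∧
      (∀ k, ‖residual (s.vec 1) (s.vec 4) (s.vec 7) (p k - p 0)‖ ≤ ‖s'.vec x‖) ∧
      ∀ y, y + 3 ≤ 10 → (x + 3 ≤ y ∨ y + 3 ≤ x) → s'.vec y = s.vec y := by
  obtain ⟨K, hK⟩ := runs_farthest
  refine ⟨K + (Program.setVec x (.var 10)).time, fun n _ p s hp => ?_⟩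
  have hfresh : (VExp.var 10).Fresh x := by
    simp [VExp.Fresh, VExp.var, RExp.vars]
    omega
  have hwrites : ∀ y ∈ farthest.realWrites, 10 ≤ y := by decide
  refine ((hK n p s hp).seq fun s1 ⟨hp1, hF, hmem, hmax⟩ =>
    (Program.loopFree_setVec x (.var 10)).runs_of ?_).mono ?_ fun _ h => h
  · rw [Program.run_setVec hfresh, VExp.eval_var]
    refine ⟨hp1.setVec _ _, by simpa using hmem, by simpa using hmax, fun y hy hxy => ?_⟩
    rw [State.vec_setVec _ _ hxy]
    exact hF.vec ⟨fun h => by have := hwrites _ h; omega, fun h => by have := hwrites _ h; omega,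
      fun h => by have := hwrites _ h; omega⟩
  · rw [add_mul]
    exact Nat.add_le_add_left (Nat.le_mul_of_pos_right _ NeZero.one_le) _

lemma runs_setReference : ∃ K : ℕ, ∀ (n : ℕ) [NeZero n] (p : Fin n → Point) (s : State),
    HasPoints p s → s.vec 1 = 0 → s.vec 4 = 0 → s.vec 7 = 0 →
    Runs setReference s (K * n) fun s' => (HasPoints p s' ∧
      ∃ v : Fin 3 → Point, IsGreedy p 0 v ∧ s'.vec 1 = v 0 ∧ s'.vec 4 = v 1 ∧ s'.vec 7 = v 2)
      ∧ setReference.Frame s s' := by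
  obtain ⟨K1, hK1⟩ := runs_farthest_setVec (x := 1) (by decide)
  obtain ⟨K2, hK2⟩ := runs_farthest_setVec (x := 4) (by decide)
  obtain ⟨K3, hK3⟩ := runs_farthest_setVec (x := 7) (by decide)
  refine ⟨K1 + (K2 + K3), fun n _ p s hp z1 z4 z7 => Runs.frame ?_⟩
  rw [add_mul, add_mul]
  refine (hK1 n p s hp).seq fun s1 ⟨hp1, mem1, max1, fr1⟩ =>
    (hK2 n p s1 hp1).seq fun s2 ⟨hp2, mem2, max2, fr2⟩ =>
    (hK3 n p s2 hp2).mono le_rfl fun s3 ⟨hp3, mem3, max3, fr3⟩ => ?_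
  have e14 : s1.vec 4 = 0 := (fr1 4 (by decide) (by decide)).trans z4
  have e17 : s1.vec 7 = 0 := (fr1 7 (by decide) (by decide)).trans z7
  have e21 : s2.vec 1 = s1.vec 1 := fr2 1 (by decide) (by decide)
  have e27 : s2.vec 7 = 0 := (fr2 7 (by decide) (by decide)).trans e17
  have e31 : s3.vec 1 = s1.vec 1 := (fr3 1 (by decide) (by decide)).trans e21
  have e34 : s3.vec 4 = s2.vec 4 := fr3 4 (by decide) (by decide)
  rw [z1, z4, z7] at mem1 max1
  rw [e14, e17] at mem2 max2
  rw [e21, e27] at mem3 max3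
  exact ⟨hp3, ![s1.vec 1, s2.vec 4, s3.vec 7], ⟨mem1, mem2, mem3, max1, max2, max3⟩, e31, e34, rfl⟩

/-- After `setStart`, the invariant of the search holds. -/
lemma run_setStart {n : ℕ} [NeZero n] {p : Fin n → Point} {v : Fin 3 → Point} {s : State}
    (hp : HasPoints p s) (hv : IsGreedy p 0 v) (h1 : s.vec 1 = v 0) (h4 : s.vec 4 = v 1)
    (h7 : s.vec 7 = v 2) :
    SearchInv p v (‖v 1‖ ^ 2 / ‖v 0‖ ^ 2) (‖v 2‖ ^ 2 / ‖v 1‖ ^ 2) (s.realVar 0 / (2 * 10 ^ 14))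
        (setStart.run s) ∧
      (setStart.run s).realVar 38 = (8 * ∏ i, ‖v i‖) ^ 2 := by
  set B := centredBox (p 0) v hv.orthogonal with hB
  have hrun : setStart.run s = (((((((s.setReal 38 ((8 * ∏ i, ‖v i‖) ^ 2)).setVec 40
      B.corner).setVec 43 (B.edge 0)).setVec 46 (B.edge 1)).setVec 49 (B.edge 2)).setReal 35
      (s.realVar 0 / (2 * 10 ^ 14))).setReal 36 (‖v 1‖ ^ 2 / ‖v 0‖ ^ 2)).setReal 37
      (‖v 2‖ ^ 2 / ‖v 1‖ ^ 2) := by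
    have hq : RExp.eval s (.const 64 * VExp.dot (.var 1) (.var 1) * VExp.dot (.var 4) (.var 4)
        * VExp.dot (.var 7) (.var 7)) = (8 * ∏ i, ‖v i‖) ^ 2 := by
      simp [h1, h4, h7, Fin.prod_univ_three]
      ring
    simp only [setStart, Program.run, hq]
    rw [Program.run_setVec (by decide), Program.run_setVec (by decide),
      Program.run_setVec (by decide), Program.run_setVec (by decide)]
    simp [State.vec_setVec, State.realVar_setVec, State.vec_setReal, h1, h4, h7, hB, centredBox,
      IExp.eval, hp.vector_zero, Fin.sum_univ_three]
  rw [hrun]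
  refine ⟨⟨⟨by simpa using hp.count, fun k => by simpa using hp.vector k⟩, ?_, ?_, ?_, ?_, ?_, ?_, B,
    hv.centredBox_bounds, ?_, ?_, ?_, ?_, ?_⟩, ?_⟩
  · simpa [State.vec_setVec, State.vec_setReal] using h1
  · simpa [State.vec_setVec, State.vec_setReal] using h4
  · simpa [State.vec_setVec, State.vec_setReal] using h7
  · simp
  · simp
  · simp
  · simp [State.realVar_setVec, hB, vol_centredBox]
  · simp [State.vec_setVec, State.vec_setReal]
  · simp [State.vec_setVec, State.vec_setReal]
  · simp [State.vec_setVec, State.vec_setReal]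
  · simp [State.vec_setReal]
  · simp [State.realVar_setVec]

lemma outputs_run_outputBox {s : State} {B : Box} (h0 : s.vec 40 = B.corner)
    (h1 : s.vec 43 = B.edge 0) (h2 : s.vec 46 = B.edge 1) (h3 : s.vec 49 = B.edge 2) :
    (outputBox.run s).Outputs B := by
  refine ⟨?_, fun i => ?_⟩
  · rw [← h0]
    ext j
    fin_cases j <;>
      simp [outputBox, outputVec, Program.run, State.vector, State.vec, IExp.eval]
  · fin_cases i
    · refine Eq.trans ?_ h1
      ext j
      fin_cases j <;>
        simp [outputBox, outputVec, Program.run, State.vector, State.vec, IExp.eval]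
    · refine Eq.trans ?_ h2
      ext j
      fin_cases j <;>
        simp [outputBox, outputVec, Program.run, State.vector, State.vec, IExp.eval]
    · refine Eq.trans ?_ h3
      ext j
      fin_cases j <;>
        simp [outputBox, outputVec, Program.run, State.vector, State.vec, IExp.eval]

lemma hasPoints_input {n : ℕ} (p : Fin n → Point) (ε : ℝ) : HasPoints p (input p ε) := by
  refine ⟨by simp [input], fun k => ?_⟩
  ext j
  simp [State.vector, input]

lemma vec_input {n : ℕ} (p : Fin n → Point) (ε : ℝ) {x : ℕ} (hx : x ≠ 0) :
    (input p ε).vec x = 0 := by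
  ext j
  simp [State.vec, input, hx]

/-- When the search ends, the volume of the best box exceeds the minimum by a factor of at most
`1 + ε`: some point of the grid is close to the parameters of an optimal frame. -/
lemma vol_le_of_search {n : ℕ} [NeZero n] {p : Fin n → Point} {v : Fin 3 → Point} {ε lam mu : ℝ}
    (hv : IsGreedy p 0 v) (h0 : ∀ i, v i ≠ 0) (hε : 0 < ε) (hε1 : ε ≤ 1)
    (hB : ‖v 1‖ ^ 2 = lam * ‖v 0‖ ^ 2) (hC : ‖v 2‖ ^ 2 = mu * ‖v 1‖ ^ 2)
    {q : ℝ} (hq : ∀ i j k : ℕ, -7000 + i * (ε / (2 * 10 ^ 14)) ≤ 7000 →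
      -7000 + j * (ε / (2 * 10 ^ 14)) ≤ 7000 → -7000 + k * (ε / (2 * 10 ^ 14)) ≤ 7000 →
      q ≤ frameVolSq p v lam mu (-7000 + i * (ε / (2 * 10 ^ 14)))
        (-7000 + j * (ε / (2 * 10 ^ 14))) (-7000 + k * (ε / (2 * 10 ^ 14))))
    {Bopt : Box} (hopt : Bopt.IsMinVolume (Set.range p)) {u : Fin 3 → Point}
    (hu : Orthonormal ℝ u) (hvol : Bopt.vol = ∏ i, width p (u i)) :
    q ≤ ((1 + ε) * Bopt.vol) ^ 2 := by
  have hle : ∏ i, width p (u i) ≤ 8 * ∏ i, ‖v i‖ := by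
    rw [← hvol, ← vol_centredBox hv.orthogonal]
    exact hopt.2 _ hv.centredBox_bounds
  obtain ⟨s, t, r, hs, ht, hr, H⟩ := exists_good_parameters hv.isReference h0 hB hC hu hle hε hε1
  have hd : 0 < ε / (2 * 10 ^ 14) := by positivity
  obtain ⟨i, hi, hi', hi''⟩ := exists_grid_point hd hs
  obtain ⟨j, hj, hj', hj''⟩ := exists_grid_point hd ht
  obtain ⟨k, hk, hk', hk''⟩ := exists_grid_point hd hr
  refine (hq i j k hi hj hk).trans ?_
  rw [hvol]
  exact pow_le_pow_left₀ (Finset.prod_nonneg fun i _ =>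
    div_nonneg (width_nonneg p _) (norm_nonneg _)) (H _ _ _ hi' hj' hk' hi'' hj'' hk'') 2

/-- The number of steps needed to cover an interval is bounded by a multiple of `1 / ε`. -/
lemma exists_num_steps {ε : ℝ} (hε : 0 < ε) (hε1 : ε ≤ 1) :
    ∃ N : ℕ, 1 ≤ N ∧ 2 * 7000 < N * (ε / (2 * 10 ^ 14)) ∧ (N : ℝ) ≤ 10 ^ 19 / ε := by
  -- `2 * 7000 * (2 * 10 ^ 14) = 28 * 10 ^ 17`
  refine ⟨⌊28 * 10 ^ 17 / ε⌋₊ + 1, Nat.le_add_left _ _, ?_, ?_⟩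
  · have h := Nat.lt_floor_add_one (28 * 10 ^ 17 / ε)
    rw [div_lt_iff₀ hε] at h
    push_cast
    linarith
  · have h := Nat.floor_le (a := 28 * 10 ^ 17 / ε) (by positivity)
    have h1 : 1 ≤ 1 / ε := (le_div_iff₀ hε).2 (by linarith)
    have e1 : 28 * 10 ^ 17 / ε = 28 * 10 ^ 17 * (1 / ε) := by ring
    have e2 : 10 ^ 19 / ε = 10 ^ 19 * (1 / ε) := by ring
    rw [e1] at h
    rw [e1, e2]
    push_cast
    linarith

/-- The program computes the required box, in time `K * n * N ^ 3` where `N` is the number of steps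
in each of the three parameters. -/
lemma runs_minBoxProgram : ∃ K : ℕ, ∀ (n : ℕ) [NeZero n] (p : Fin n → Point) (ε : ℝ), 0 < ε →
    ε ≤ 1 → ∀ N : ℕ, 1 ≤ N → 2 * 7000 < N * (ε / (2 * 10 ^ 14)) →
    ∀ (Bopt : Box), Bopt.IsMinVolume (Set.range p) →
    ∀ u : Fin 3 → Point, Orthonormal ℝ u → Bopt.vol = ∏ i, width p (u i) →
    Runs minBoxProgram (input p ε) (K * (n * N ^ 3)) fun s => ∃ B : Box, s.Outputs B ∧
      B.Bounds (Set.range p) ∧ B.vol ≤ (1 + ε) * Bopt.vol := by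
  obtain ⟨K, hK⟩ := runs_setReference
  obtain ⟨K', hK'⟩ := runs_search
  refine ⟨K + setStart.time + ((Test.rlt (.const 0) (.var 38)).cost + 1 + K' + 1) + outputBox.time,
    fun n _ p ε hε hε1 N hN1 hN Bopt hopt u hu hvol => ?_⟩
  have hn : 1 ≤ n := NeZero.one_le
  have hM : 1 ≤ n * N ^ 3 := Nat.mul_pos hn (pow_pos hN1 3)
  have hnM : n ≤ n * N ^ 3 := Nat.le_mul_of_pos_right n (pow_pos hN1 3)
  have free : setStart.LoopFree := ⟨trivial, Program.loopFree_setVec _ _,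
    Program.loopFree_setVec _ _, Program.loopFree_setVec _ _, Program.loopFree_setVec _ _, trivial,
    trivial, trivial⟩
  have free' : outputBox.LoopFree := ⟨⟨trivial, trivial, trivial⟩, ⟨trivial, trivial, trivial⟩,
    ⟨trivial, trivial, trivial⟩, trivial, trivial, trivial⟩
  have hopt0 : 0 ≤ Bopt.vol := Finset.prod_nonneg fun i _ => norm_nonneg _
  have hrun : Runs minBoxProgram (input p ε) (K * n + (setStart.time
      + (((Test.rlt (.const 0) (.var 38)).cost + 1 + (K' * (n * N ^ 3) + 1)) + outputBox.time)))
      fun s => ∃ B : Box, s.Outputs B ∧ B.Bounds (Set.range p) ∧ B.vol ≤ (1 + ε) * Bopt.vol := by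
    refine (hK n p _ (hasPoints_input p ε) (vec_input p ε (by decide)) (vec_input p ε (by decide))
      (vec_input p ε (by decide))).seq fun s1 ⟨⟨hp1, v, hv, h1, h4, h7⟩, hF⟩ => ?_
    have hε' : s1.realVar 0 = ε := (hF.realVar 0 (by decide)).trans (by simp [input])
    obtain ⟨hinv, hq⟩ := run_setStart hp1 hv h1 h4 h7
    rw [hε'] at hinv
    refine (free.runs_of ⟨hinv, hq⟩ :
      Runs setStart s1 _ fun s => SearchInv p v (‖v 1‖ ^ 2 / ‖v 0‖ ^ 2) (‖v 2‖ ^ 2 / ‖v 1‖ ^ 2)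
        (ε / (2 * 10 ^ 14)) s ∧ s.realVar 38 = (8 * ∏ i, ‖v i‖) ^ 2).seq fun s2 ⟨i2, q2⟩ => ?_
    have hsearch : Runs (.branch (.rlt (.const 0) (.var 38)) search .skip) s2
        ((Test.rlt (.const 0) (.var 38)).cost + 1 + (K' * (n * N ^ 3) + 1))
        fun s => StoresBox p s ∧ s.realVar 38 ≤ ((1 + ε) * Bopt.vol) ^ 2 := by
      refine Runs.branch (fun hb => ?_) fun hb => ?_
      · have hpos : (0 : ℝ) < (8 * ∏ i, ‖v i‖) ^ 2 := by
          rw [← q2]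
          simpa [Test.eval] using hb
        have h0 : ∀ i, v i ≠ 0 := fun i hi => by
          have : ∏ i, ‖v i‖ = 0 := Finset.prod_eq_zero (Finset.mem_univ i) (by simp [hi])
          simp [this] at hpos
        have hn0 := norm_ne_zero_iff.2 (h0 0)
        have hn1 := norm_ne_zero_iff.2 (h0 1)
        have hB : ‖v 1‖ ^ 2 = ‖v 1‖ ^ 2 / ‖v 0‖ ^ 2 * ‖v 0‖ ^ 2 := by field_simp
        have hC : ‖v 2‖ ^ 2 = ‖v 2‖ ^ 2 / ‖v 1‖ ^ 2 * ‖v 1‖ ^ 2 := by field_simp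
        refine (hK' n p v _ _ _ hv.orthogonal h0 hB hC (by positivity) (by positivity)
          (by positivity) N hN1 hN s2 i2).mono (Nat.le_succ _) fun s ⟨hs, hlow⟩ => ⟨hs.box, ?_⟩
        exact vol_le_of_search hv h0 hε hε1 hB hC hlow hopt hu hvol
      -- the first box has volume `0` and is therefore optimal
      · refine ⟨1, s2, .skip s2, Nat.le_add_left _ _, i2.box, ?_⟩
        have : s2.realVar 38 ≤ 0 := by simpa [Test.eval] using hb
        exact this.trans (sq_nonneg _)
    refine hsearch.seq fun s3 ⟨⟨B, b1, b2, b3, b4, b5, b6⟩, hle⟩ => free'.runs_of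
      ⟨B, outputs_run_outputBox b3 b4 b5 b6, b1, ?_⟩
    rw [b2] at hle
    exact le_of_sq_le_sq hle (mul_nonneg (by linarith) hopt0)
  refine hrun.mono ?_ fun _ h => h
  generalize (Test.rlt (.const 0) (.var 38)).cost = c
  nlinarith [Nat.mul_le_mul_left K hnM, Nat.mul_le_mul_left setStart.time hM,
    Nat.mul_le_mul_left c hM, Nat.mul_le_mul_left outputBox.time hM]

end MinBox

theorem mainTheorem2 :
    ∃ (P : RealRAM.Program) (C : ℝ), ∀ (n : ℕ) (p : Fin n → Point) (ε : ℝ),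
      1 ≤ n → 0 < ε → ε ≤ 1 →
      ∃ (t : ℕ) (s : RealRAM.State) (B Bopt : Box),
        RealRAM.Exec P (RealRAM.input p ε) t s ∧
        (t : ℝ) ≤ C * ((n : ℝ) * Real.log (n : ℝ) + (n : ℝ) / ε ^ 3) ∧
        s.Outputs B ∧
        B.Bounds (Set.range p) ∧
        Bopt.IsMinVolume (Set.range p) ∧
        B.vol ≤ (1 + ε) * Bopt.vol := by
  obtain ⟨K, hK⟩ := MinBox.runs_minBoxProgram
  refine ⟨MinBox.minBoxProgram, K * (10 ^ 19) ^ 3, fun n p ε hn hε hε1 => ?_⟩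
  have : NeZero n := ⟨by omega⟩
  obtain ⟨Bopt, u, hopt, hu, hvol⟩ := MinBox.exists_isMinVolume p
  obtain ⟨N, hN1, hN, hNε⟩ := MinBox.exists_num_steps hε hε1
  obtain ⟨t, s, hexec, ht, B, hout, hB, hle⟩ := hK n p ε hε hε1 N hN1 hN Bopt hopt u hu hvol
  refine ⟨t, s, B, Bopt, hexec, ?_, hout, hB, hopt, hle⟩
  have hlog : 0 ≤ (n : ℝ) * Real.log n :=
    mul_nonneg (Nat.cast_nonneg n) (Real.log_natCast_nonneg n)
  calc (t : ℝ) ≤ ((K * (n * N ^ 3) : ℕ) : ℝ) := by exact_mod_cast ht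
    _ = K * (n * (N : ℝ) ^ 3) := by push_cast; ring
    _ ≤ K * (n * (10 ^ 19 / ε) ^ 3) := by gcongr
    _ = K * (10 ^ 19) ^ 3 * (0 + n / ε ^ 3) := by ring
    _ ≤ K * (10 ^ 19) ^ 3 * (n * Real.log n + n / ε ^ 3) := by gcongr
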